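/- A geometry is a set $X$ of points with a family of subsets, called subspaces, that contains $\emptyset$, $X$ and all one-point sets, is closed under arbitrary intersections, and satisfies two axioms, in which $\overline{A}$ denotes the least subspace containing $A\subseteq X$. Exchange: if $S$ is a subspace and $x\notin S$, no subspace lies strictly between $S$ and $\overline{S\cup\{x\}}$. Finitary: if $x\in\overline{A}$ then $x\in\overline{B}$ for some finite $B\subseteq A$. A basis of a subspace $S$ is a set $B$ with $\overline{B}=S$ and $b\notin\overline{B\setminus\{b\}}$ for all $b\in B$; the dimension of $S$ is the cardinal of its bases minus $1$. Lines and planes are the subspaces of dimension $1$ and $2$. A subset $A\subseteq X$ is a geometry (a subgeometry) with subspaces $S\cap A$, for $S$ a subspace of $X$. A morphism of geometries is a map under which preimages of subspaces are subspaces; an isomorphism is a bijective morphism whose inverse is a morphism; a morphism $f\colon X\to X'$ is an embedding if $X\to f(X)$ is an isomorphism onto the subgeometry $f(X)$. For $x\in X$, the quotient $X/x$ is the set of classes $[y]$ of points $y\ne x$, where $[y]=[z]$ iff $\overline{\{y,x\}}=\overline{\{z,x\}}$; if $X$ is a subgeometry of $Y$ and $x\in X$ then $X/x\subseteq Y/x$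 via $[y]\mapsto[y]$. A geometry has enough points if its dimension is at least $2$ and every plane of it contains four points, no three of which are collinear. Let $V$ and $V'$ be left vector spaces over division rings $K$ and $K'$, and let $\mathbb{P}=\mathbb{P}(V)$ and $\mathbb{P}'=\mathbb{P}(V')$, regarded as geometries whose subspaces are the sets $\mathbb{P}(W)$ for vector subspaces $W$. A semilinear map $\Phi\colon V\to V'$ is an additive map with $\Phi(\lambda v)=\sigma(\lambda)\Phi(v)$ for some ring morphism $\sigma\colon K\to K'$ (not necessarily surjective); it induces the partial map $\mathbb{P}\dashrightarrow\mathbb{P}'$, $\langle v\rangle\mapsto\langle\Phi(v)\rangle$, defined on the complement of $\mathbb{P}(\ker\Phi)$. The partial maps obtained in this way are called partial projective morphisms. **Theorem.** Let $X\subseteq\mathbb{P}$ be a subgeometry with enough points, and let $\varphi\colon X\to\mathbb{P}'$ be a morphism of geometries such that 1. the image of $\varphi$ is not contained in a subspace of $\mathbb{P}'$ of dimension $\le 2$; 2. there are $x_1,x_2\in X$ with $X/x_i=\mathbb{P}/x_i$ for $i=1,2$ and $\varphi(x_1)\ne\varphi(x_2)$. Then there is a unique partial projective morphism $\phi\colon\mathbb{P}\dashrightarrow\mathbb{P}'$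 that is defined at every point of $X$ and satisfies $\phi|_X=\varphi$. Moreover: (a) if $\varphi$ is injective, then $\phi$ is defined on all of $\mathbb{P}$; (b) if $\varphi$ is an embedding of geometries, then $\phi$ is defined on all of $\mathbb{P}$ and $\phi\colon\mathbb{P}\to\mathbb{P}'$ is an embedding of geometries. -/

import Mathlib

open scoped LinearAlgebra.Projectivization

/-- The least member of the family `F` of subsets of `X` containing `A`
(when `F` is stable under intersections): the intersection of all members containing `A`. -/
def flatClosure {X : Type*} (F : Set (Set X)) (A : Set X) : Set X :=
  ⋂₀ {T | T ∈ F ∧ A ⊆ T}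

/-- A geometry: a set of points with a family of subspaces (flats) which contains the empty set,
the whole set and the points, is stable under intersections, and satisfies the exchange axiom and
the finitary axiom. -/
structure PointGeometry (X : Type*) where
  flats : Set (Set X)
  empty_mem : ∅ ∈ flats
  univ_mem : Set.univ ∈ flats
  singleton_mem : ∀ x : X, {x} ∈ flats
  sInter_mem : ∀ 𝒮 : Set (Set X), 𝒮 ⊆ flats → ⋂₀ 𝒮 ∈ flats
  exchange : ∀ S ∈ flats, ∀ x ∉ S,
    ¬ ∃ S' ∈ flats, S ⊂ S' ∧ S' ⊂ flatClosure flats (insert x S)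
  finitary : ∀ (A : Set X) (x : X), x ∈ flatClosure flats A →
    ∃ B : Set X, B.Finite ∧ B ⊆ A ∧ x ∈ flatClosure flats B

namespace PointGeometry

variable {X X' : Type*}

/-- The closure of a subset. -/
def cl (G : PointGeometry X) (A : Set X) : Set X := flatClosure G.flats A

theorem subset_cl (G : PointGeometry X) (A : Set X) : A ⊆ G.cl A :=
  fun _ ha _ hT => hT.2 ha

theorem cl_mem (G : PointGeometry X) (A : Set X) : G.cl A ∈ G.flats :=
  G.sInter_mem _ fun _ hT => hT.1

theorem cl_subset (G : PointGeometry X) {A S : Set X} (hS : S ∈ G.flats) (h : A ⊆ S) :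
    G.cl A ⊆ S :=
  fun _ hx => hx S ⟨hS, h⟩

theorem cl_mono (G : PointGeometry X) {A B : Set X} (h : A ⊆ B) : G.cl A ⊆ G.cl B :=
  G.cl_subset (G.cl_mem B) (h.trans (G.subset_cl B))

/-- `A` is independent when no `a ∈ A` lies in the closure of the other elements. -/
def Indep (G : PointGeometry X) (A : Set X) : Prop :=
  ∀ a ∈ A, a ∉ G.cl (A \ {a})

/-- `B` is a basis of the subspace `S`. -/
def IsBasis (G : PointGeometry X) (B S : Set X) : Prop :=
  G.Indep B ∧ G.cl B = S

/-- `S` is a subspace of dimension `n`: it has a basis with `n + 1` elements. -/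
def HasDim (G : PointGeometry X) (S : Set X) (n : ℕ) : Prop :=
  S ∈ G.flats ∧ ∃ B, G.IsBasis B S ∧ B.encard = n + 1

/-- Lines are the subspaces of dimension one. -/
def IsLine (G : PointGeometry X) (S : Set X) : Prop := G.HasDim S 1

/-- Planes are the subspaces of dimension two. -/
def IsPlane (G : PointGeometry X) (S : Set X) : Prop := G.HasDim S 2

/-- A geometry has enough points when its dimension is at least two and each of its planes has
four points, no three of which are collinear. -/
def EnoughPoints (G : PointGeometry X) : Prop :=
  (∃ B, G.IsBasis B Set.univ ∧ 3 ≤ B.encard) ∧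
  ∀ P, G.IsPlane P → ∃ Q ⊆ P, Q.encard = 4 ∧
    ∀ T ⊆ Q, T.encard = 3 → ¬ ∃ L, G.IsLine L ∧ T ⊆ L

/-- Morphisms of geometries: the preimage of a subspace is a subspace. -/
def IsMorphism (G : PointGeometry X) (G' : PointGeometry X') (f : X → X') : Prop :=
  ∀ S ∈ G'.flats, f ⁻¹' S ∈ G.flats

/-- Isomorphisms of geometries: bijective morphisms whose inverse is a morphism. -/
def IsIsomorphism (G : PointGeometry X) (G' : PointGeometry X') (f : X → X') : Prop :=
  G.IsMorphism G' f ∧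
  ∃ g : X' → X, Function.LeftInverse g f ∧ Function.RightInverse g f ∧ G'.IsMorphism G g

theorem cl_sub_aux (G : PointGeometry X) (A : Set X) (T : Set A) :
    flatClosure {T : Set A | ∃ S ∈ G.flats, T = Subtype.val ⁻¹' S} T =
      Subtype.val ⁻¹' G.cl (Subtype.val '' T) := by
  apply Set.Subset.antisymm
  · intro x hx
    exact hx _ ⟨⟨_, G.cl_mem _, rfl⟩, fun t ht => G.subset_cl _ ⟨t, ht, rfl⟩⟩
  · rintro x hx _ ⟨⟨S, hS, rfl⟩, hT⟩
    exact G.cl_subset hS (by rintro _ ⟨t, ht, rfl⟩; exact hT ht) hx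

/-- A subset `A` as a subgeometry: its subspaces are the sets `S ∩ A` with `S` a subspace. -/
def sub (G : PointGeometry X) (A : Set X) : PointGeometry A where
  flats := {T | ∃ S ∈ G.flats, T = Subtype.val ⁻¹' S}
  empty_mem := ⟨∅, G.empty_mem, rfl⟩
  univ_mem := ⟨Set.univ, G.univ_mem, rfl⟩
  singleton_mem x := ⟨{x.1}, G.singleton_mem x.1, by ext y; simp [Subtype.ext_iff]⟩
  sInter_mem 𝒮 h𝒮 := by
    refine ⟨⋂₀ {S | S ∈ G.flats ∧ Subtype.val ⁻¹' S ∈ 𝒮}, G.sInter_mem _ fun S hS => hS.1, ?_⟩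
    ext y
    constructor
    · rintro hy S ⟨_, hS⟩
      exact hy _ hS
    · intro hy T hT
      obtain ⟨S, hS, rfl⟩ := h𝒮 hT
      exact hy S ⟨hS, hT⟩
  exchange := by
    rintro T ⟨S, hS, rfl⟩ x hx ⟨T', ⟨S', hS', rfl⟩, h1, h2⟩
    rw [cl_sub_aux] at h2
    obtain ⟨y, hyS', hyS⟩ := Set.exists_of_ssubset h1
    set C := G.cl (Subtype.val '' (Subtype.val ⁻¹' S : Set A)) with hC
    have hCS : C ⊆ S := G.cl_subset hS (by rintro _ ⟨t, ht, rfl⟩; exact ht)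
    have hTC : Subtype.val '' (Subtype.val ⁻¹' S : Set A) ⊆ C := G.subset_cl _
    have hxC : x.1 ∉ C := fun h => hx (hCS h)
    have hyC : y.1 ∉ C := fun h => hyS (hCS h)
    have hle : G.cl (Subtype.val '' insert x (Subtype.val ⁻¹' S : Set A)) ⊆
        G.cl (insert x.1 C) := by
      apply G.cl_mono
      rw [Set.image_insert_eq]
      exact Set.insert_subset_insert hTC
    have hy2 : y.1 ∈ G.cl (insert x.1 C) := hle (h2.subset hyS')
    have hsub : G.cl (insert y.1 C) ⊆ G.cl (insert x.1 C) :=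
      G.cl_subset (G.cl_mem _) (Set.insert_subset hy2
        ((Set.subset_insert _ _).trans (G.subset_cl _)))
    have hx2 : x.1 ∈ G.cl (insert y.1 C) := by
      by_contra hne
      refine G.exchange C (G.cl_mem _) x.1 hxC ⟨G.cl (insert y.1 C), G.cl_mem _, ?_, ?_⟩
      · refine ⟨(Set.subset_insert _ _).trans (G.subset_cl _), fun h => hyC (h ?_)⟩
        exact G.subset_cl _ (Set.mem_insert _ _)
      · exact ⟨hsub, fun h => hne (h (G.subset_cl _ (Set.mem_insert _ _)))⟩
    have hTS' : Subtype.val '' (Subtype.val ⁻¹' S : Set A) ⊆ S' := by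
      rintro _ ⟨t, ht, rfl⟩; exact h1.subset ht
    have hxS' : x.1 ∈ S' :=
      G.cl_subset hS' (Set.insert_subset hyS' (G.cl_subset hS' hTS')) hx2
    refine h2.2 fun z hz => G.cl_subset hS' ?_ hz
    rw [Set.image_insert_eq]
    exact Set.insert_subset hxS' hTS'
  finitary := by
    intro T x hx
    rw [cl_sub_aux] at hx
    obtain ⟨B, hB, hBT, hxB⟩ := G.finitary _ _ hx
    refine ⟨Subtype.val ⁻¹' B, hB.preimage Subtype.val_injective.injOn, ?_, ?_⟩
    · intro b hb
      obtain ⟨t, ht, h⟩ := hBT hb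
      rwa [Subtype.val_injective h] at ht
    · rw [cl_sub_aux, Set.image_preimage_eq_of_subset]
      · exact hxB
      · intro b hb
        obtain ⟨t, _, rfl⟩ := hBT hb
        exact ⟨t, rfl⟩

theorem sub_cl (G : PointGeometry X) (A : Set X) (T : Set A) :
    (G.sub A).cl T = Subtype.val ⁻¹' G.cl (Subtype.val '' T) :=
  cl_sub_aux G A T

/-- Embeddings of geometries: morphisms `f` inducing an isomorphism of `X` onto the
subgeometry `f(X)` of `X'`. -/
def IsEmbedding (G : PointGeometry X) (G' : PointGeometry X') (f : X → X') : Prop :=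
  G.IsMorphism G' f ∧
  G.IsIsomorphism (G'.sub (Set.range f)) (Set.rangeFactorization f)

/-- The equivalence relation on `X - E` given by `x₁ ∨ E = x₂ ∨ E`. -/
def quotientSetoid (G : PointGeometry X) (E : Set X) : Setoid {x : X // x ∉ E} where
  r a b := G.cl (insert a.1 E) = G.cl (insert b.1 E)
  iseqv := ⟨fun _ => rfl, Eq.symm, Eq.trans⟩

/-- The points of the quotient `X / E`. -/
def Quot (G : PointGeometry X) (E : Set X) : Type _ := Quotient (G.quotientSetoid E)

/-- For `x ∈ A ⊆ X`, the canonical map `A / x → X / x`, `[y] ↦ [y]`. -/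
def subQuotMap (G : PointGeometry X) (A : Set X) (x : A) :
    (G.sub A).Quot {x} → G.Quot {x.1} :=
  Quotient.map (fun y => ⟨y.1.1, fun h => y.2 (Subtype.ext h)⟩) (by
    have key : ∀ a b : A, (G.sub A).cl {a, x} = (G.sub A).cl {b, x} →
        G.cl {a.1, x.1} ⊆ G.cl {b.1, x.1} := by
      intro a b h
      refine G.cl_subset (G.cl_mem _) (Set.insert_subset ?_
        ((Set.subset_insert _ _).trans (G.subset_cl _)))
      have ha : a ∈ (G.sub A).cl {b, x} := h ▸ (G.sub A).subset_cl _ (Set.mem_insert _ _)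
      rw [sub_cl, Set.image_pair] at ha
      exact ha
    intro a b h
    exact Set.Subset.antisymm (key _ _ h) (key _ _ h.symm))

end PointGeometry

section Projective

variable (K V : Type*) [DivisionRing K] [AddCommGroup V] [Module K V]

theorem projFlatClosure (A : Set (ℙ K V)) :
    flatClosure {S | ∃ T : Projectivization.Subspace K V, (T : Set (ℙ K V)) = S} A =
      Projectivization.Subspace.span A := by
  apply Set.Subset.antisymm
  · intro x hx
    exact hx _ ⟨⟨_, rfl⟩, Projectivization.Subspace.subset_span A⟩
  · rintro x hx _ ⟨⟨T, rfl⟩, hT⟩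
    exact (Projectivization.Subspace.span_le_subspace_iff.2 hT) hx

/-- The projective space `ℙ(V)` as a geometry, with its projective subspaces as flats. -/
def projGeometry : PointGeometry (ℙ K V) where
  flats := {S | ∃ T : Projectivization.Subspace K V, (T : Set (ℙ K V)) = S}
  empty_mem := ⟨⟨∅, fun _ _ _ _ _ h => h.elim⟩, rfl⟩
  univ_mem := ⟨⟨Set.univ, fun _ _ _ _ _ _ _ => trivial⟩, rfl⟩
  singleton_mem x := by
    refine ⟨⟨{x}, fun v w hv hw hvw h1 h2 => ?_⟩, rfl⟩
    rw [Set.mem_singleton_iff] at h1 h2 ⊢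
    subst h1
    obtain ⟨a, ha⟩ := (Projectivization.mk_eq_mk_iff' K w v hw hv).1 h2
    rw [Projectivization.mk_eq_mk_iff']
    exact ⟨1 + a, by rw [add_smul, one_smul, ha]⟩
  sInter_mem 𝒮 h𝒮 := by
    refine ⟨⟨⋂₀ 𝒮, fun v w hv hw hvw h1 h2 S hS => ?_⟩, rfl⟩
    obtain ⟨T, rfl⟩ := h𝒮 hS
    exact T.mem_add v w hv hw hvw (h1 _ hS) (h2 _ hS)
  exchange := by
    rintro _ ⟨S, rfl⟩ x hx ⟨_, ⟨S', rfl⟩, h1, h2⟩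
    rw [projFlatClosure] at h2
    induction x using Projectivization.ind with
    | h v hv =>
    have hlt : S < S' := h1
    have hlt' : S' < (K ∙ v ⊔ Projectivization.Subspace.submodule S).projectivization := by
      refine lt_of_lt_of_le (b := Projectivization.Subspace.span _) h2 ?_
      rw [Projectivization.Subspace.span_le_subspace_iff]
      refine Set.insert_subset ?_ fun p hp => ?_
      · exact (Submodule.mk_mem_projectivization_iff _ hv).2
          (Submodule.mem_sup_left (Submodule.mem_span_singleton_self v))
      · induction p using Projectivization.ind with
        | h w hw =>
        exact (Submodule.mk_mem_projectivization_iff _ hw).2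
          (Submodule.mem_sup_right ((Projectivization.Subspace.mem_submodule_iff S hw).2 hp))
    have hl := Projectivization.Subspace.submodule.lt_iff_lt.2 hlt
    have hr := Projectivization.Subspace.submodule.lt_iff_lt.2 hlt'
    rw [OrderIso.apply_symm_apply] at hr
    exact (Submodule.wcovBy_span_singleton_sup v _).2 hl hr
  finitary := by
    intro A x hx
    rw [projFlatClosure] at hx
    simp only [projFlatClosure]
    change Projectivization.Subspace.spanCarrier A x at hx
    induction hx with
    | of x hx =>
      exact ⟨{x}, Set.finite_singleton x, by simpa using hx,
        Projectivization.Subspace.subset_span _ rfl⟩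
    | mem_add v w hv hw hvw _ _ ih1 ih2 =>
      obtain ⟨B, hB, hBA, h1⟩ := ih1
      obtain ⟨C, hC, hCA, h2⟩ := ih2
      exact ⟨B ∪ C, hB.union hC, Set.union_subset hBA hCA,
        Projectivization.Subspace.mem_add _ v w hv hw hvw
          (Projectivization.Subspace.monotone_span Set.subset_union_left h1)
          (Projectivization.Subspace.monotone_span Set.subset_union_right h2)⟩

end Projective

section PartialProjective

variable {K V K' V' : Type*} [DivisionRing K] [AddCommGroup V] [Module K V]
  [DivisionRing K'] [AddCommGroup V'] [Module K' V']

/-- The partial map `ℙ(V) ⇢ ℙ(V')`, `⟨v⟩ ↦ ⟨Φ v⟩`, induced by a semilinear map `Φ` and defined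
where `Φ v ≠ 0`. -/
noncomputable def projPartialMap {σ : K →+* K'} (Φ : V →ₛₗ[σ] V') : ℙ K V →. ℙ K' V' :=
  fun p => ⟨Φ p.rep ≠ 0, fun h => Projectivization.mk K' (Φ p.rep) h⟩

theorem mem_projPartialMap_mk {σ : K →+* K'} (Φ : V →ₛₗ[σ] V') (v : V) (hv : v ≠ 0)
    (q : ℙ K' V') :
    q ∈ projPartialMap Φ (Projectivization.mk K v hv) ↔
      ∃ h : Φ v ≠ 0, Projectivization.mk K' (Φ v) h = q := by
  obtain ⟨a, ha⟩ := Projectivization.exists_smul_eq_mk_rep K v hv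
  have h1 : Φ (Projectivization.mk K v hv).rep = σ a • Φ v := by
    rw [← ha, Units.smul_def, map_smulₛₗ]
  have h0 : σ a ≠ 0 := (map_ne_zero σ).2 a.ne_zero
  have hz : Φ (Projectivization.mk K v hv).rep ≠ 0 ↔ Φ v ≠ 0 := by
    rw [h1]; simp [h0]
  have heq : ∀ (h : Φ (Projectivization.mk K v hv).rep ≠ 0) (h' : Φ v ≠ 0),
      Projectivization.mk K' _ h = Projectivization.mk K' _ h' := by
    intro h h'
    rw [Projectivization.mk_eq_mk_iff']
    exact ⟨σ a, h1.symm⟩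
  constructor
  · rintro ⟨h, rfl⟩
    exact ⟨hz.1 h, (heq h (hz.1 h)).symm⟩
  · rintro ⟨h, rfl⟩
    exact ⟨hz.2 h, heq (hz.2 h) h⟩

/-- Partial projective morphisms `ℙ(V) ⇢ ℙ(V')`: the partial maps induced by semilinear maps. -/
def IsPartialProjective (ϕ : ℙ K V →. ℙ K' V') : Prop :=
  ∃ (σ : K →+* K') (Φ : V →ₛₗ[σ] V'), ϕ = projPartialMap Φ

end PartialProjective

/-! On representing vectors, `φ` becomes a map `F` on the cone over `X` under which preimages of
subspaces are traces of subspaces (`IsFlatMap`). Project `ℙ'` from `φ(x₁)`. The composite `π₁ ∘ F`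
kills `x₁`, so it depends only on the line through `x₁`; since `X/x₁ = ℙ/x₁`, it extends to a flat
map on all of `V` (`IsFlatMap.exists_extend`). A fundamental theorem for everywhere defined flat
maps of rank at least three (`IsFlatMap.exists_semilinearMap`) then makes it semilinear, and
likewise for `x₂`.

The resulting maps `A` and `B` agree up to scalars after the other projection. Rank two there forces
one constant scalar, so `A` and a multiple of `B` are the two projections of a single `Φ`
(`IsFlatMap.exists_semilinearMap_glue`). Away from the line joining `φ(x₁)` and `φ(x₂)`, the two
projections determine a point, so `Φ` induces `φ` there. Points sent to that line are reached
through an auxiliary point of a plane, which is where enough points are needed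
(`IsFlatMap.exists_semilinearMap_of_centers`).

Uniqueness uses the same two projections. For (a) and (b), every vector off `⟨x₁⟩` can be moved into
the cone along `x₁`, which carries properties from `X` to `V`. -/

open scoped LinearAlgebra.Projectivization

/-! ### Spans of one, two and three vectors -/

section LinearAlgebraLemmas

variable {K V : Type*} [DivisionRing K] [AddCommGroup V] [Module K V]

theorem mem_span_singleton_symm {x y : V} (hy : y ≠ 0) (h : y ∈ K ∙ x) : x ∈ K ∙ y := by
  obtain ⟨a, rfl⟩ := Submodule.mem_span_singleton.1 h
  have ha : a ≠ 0 := fun h0 => hy (by rw [h0, zero_smul])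
  exact Submodule.mem_span_singleton.2 ⟨a⁻¹, by rw [smul_smul, inv_mul_cancel₀ ha, one_smul]⟩

theorem mem_span_singleton_trans {x y z : V} (h : x ∈ K ∙ y) (h' : y ∈ K ∙ z) : x ∈ K ∙ z :=
  (Submodule.span_singleton_le_iff_mem _ _).2 h' h

theorem span_singleton_eq_of_mem {x y : V} (hy : y ≠ 0) (h : y ∈ K ∙ x) :
    (K ∙ y) = K ∙ x :=
  le_antisymm ((Submodule.span_singleton_le_iff_mem _ _).2 h)
    ((Submodule.span_singleton_le_iff_mem _ _).2 (mem_span_singleton_symm hy h))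

theorem linearIndependent_triple_iff {x y z : V} :
    LinearIndependent K ![x, y, z] ↔
      ∀ a b c : K, a • x + b • y + c • z = 0 → a = 0 ∧ b = 0 ∧ c = 0 := by
  rw [Fintype.linearIndependent_iff]
  constructor
  · intro h a b c habc
    have := h ![a, b, c] (by simpa [Fin.sum_univ_three] using habc)
    exact ⟨this 0, this 1, this 2⟩
  · intro h g hg
    obtain ⟨h0, h1, h2⟩ := h (g 0) (g 1) (g 2) (by simpa [Fin.sum_univ_three] using hg)
    intro i
    fin_cases i <;> assumption

theorem linearIndependent_triple_of_notMem {x y z : V} (hx : x ≠ 0) (hy : y ∉ K ∙ x)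
    (hz : z ∉ Submodule.span K {x, y}) : LinearIndependent K ![x, y, z] := by
  rw [linearIndependent_triple_iff]
  intro a b c h
  have hc : c = 0 := by
    by_contra hc
    refine hz (Submodule.mem_span_pair.2 ⟨-(c⁻¹ * a), -(c⁻¹ * b), ?_⟩)
    have : z = c⁻¹ • (c • z) := by rw [smul_smul, inv_mul_cancel₀ hc, one_smul]
    rw [this, ← neg_eq_of_add_eq_zero_right h]
    simp only [smul_neg, smul_add, neg_smul, mul_smul]
    abel
  subst hc
  rw [zero_smul, add_zero] at h
  have hb : b = 0 := by
    by_contra hb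
    refine hy (Submodule.mem_span_singleton.2 ⟨-(b⁻¹ * a), ?_⟩)
    have : y = b⁻¹ • (b • y) := by rw [smul_smul, inv_mul_cancel₀ hb, one_smul]
    rw [this, ← neg_eq_of_add_eq_zero_right h]
    simp only [smul_neg, neg_smul, mul_smul]
  subst hb
  rw [zero_smul, add_zero, smul_eq_zero] at h
  exact ⟨h.resolve_right hx, rfl, rfl⟩

/-- By counting dimensions, a frame of three always has a member in general position to two given
vectors. This is how rank three enters the fundamental theorem. -/
theorem LinearIndependent.exists_notMem_span_pair {e : Fin 3 → V} (he : LinearIndependent K e)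
    (p q : V) : ∃ i, e i ∉ Submodule.span K {p, q} := by
  by_contra! h
  classical
  have := linearIndependent_le_span' e he (({p, q} : Finset V) : Set V)
    (by rintro _ ⟨i, rfl⟩; simpa using h i)
  have h2 := Finset.card_le_two (a := p) (b := q)
  have h3 : 3 ≤ ({p, q} : Finset V).card := by
    simp only [Finset.coe_sort_coe, Fintype.card_coe, Cardinal.mk_fin] at this
    exact_mod_cast this
  omega

end LinearAlgebraLemmas

/-! ### Flat maps and representatives compatible with differences -/

section FlatMap

variable (K K' : Type*) {V V' : Type*} [DivisionRing K] [AddCommGroup V] [Module K V]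
  [DivisionRing K'] [AddCommGroup V'] [Module K' V']

/-- On the set `X` of vectors, preimages under `F` of vector subspaces are traces of vector
subspaces. -/
def IsFlatMap (X : Set V) (F : V → V') : Prop :=
  ∀ T : Submodule K' V', ∃ W : Submodule K V, ∀ x ∈ X, x ∈ W ↔ F x ∈ T

variable {K K'}

theorem IsFlatMap.mem_of_mem_span {X : Set V} {F : V → V'} (h : IsFlatMap K K' X F)
    {T : Submodule K' V'} {s : Set V} (hsX : s ⊆ X) (hs : ∀ x ∈ s, F x ∈ T) {v : V} (hv : v ∈ X)
    (hvs : v ∈ Submodule.span K s) : F v ∈ T := by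
  obtain ⟨W, hW⟩ := h T
  rw [← hW v hv]
  exact Submodule.span_le.2 (fun x hx => (hW x (hsX hx)).2 (hs x hx)) hvs

theorem IsFlatMap.mem_span_pair {G : V → V'} (h : IsFlatMap K K' Set.univ G) {u v w : V}
    (hu : u ∈ Submodule.span K {v, w}) : G u ∈ Submodule.span K' {G v, G w} :=
  h.mem_of_mem_span (Set.subset_univ _)
    (by
      rintro x (rfl | rfl)
      · exact Submodule.subset_span (Set.mem_insert _ _)
      · exact Submodule.subset_span (Set.mem_insert_of_mem _ rfl)) (Set.mem_univ _) hu

theorem IsFlatMap.mem_span_singleton {G : V → V'} (h : IsFlatMap K K' Set.univ G) {u v : V}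
    (hu : u ∈ K ∙ v) : G u ∈ K' ∙ G v :=
  h.mem_of_mem_span (Set.subset_univ _)
    (by rintro x rfl; exact Submodule.mem_span_singleton_self _) (Set.mem_univ _) hu

theorem span_pair_le_singleton {x y z : V} (hx : x ∈ K ∙ z) (hy : y ∈ K ∙ z) :
    Submodule.span K {x, y} ≤ K ∙ z :=
  Submodule.span_le.2 (by rintro _ (rfl | rfl) <;> assumption)

theorem mem_span_pair_of_eq {u v w : V} (a b : K) (h : a • v + b • w = u) :
    u ∈ Submodule.span K {v, w} := Submodule.mem_span_pair.2 ⟨a, b, h⟩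

/-- Since `u = (u - v) + v`, a vector over `G u` splits into a part along `G (u - v)` and a part
along `G v`. This normalises the representative at `v` against the one at `u`. -/
theorem IsFlatMap.exists_sub_mem {G : V → V'} (h : IsFlatMap K K' Set.univ G) {u v : V} {u' : V'}
    (hu : u' ∈ K' ∙ G u) : ∃ v' ∈ K' ∙ G v, u' - v' ∈ K' ∙ G (u - v) := by
  have h1 : G u ∈ Submodule.span K' {G (u - v), G v} :=
    h.mem_span_pair (mem_span_pair_of_eq 1 1 (by simp))
  obtain ⟨c, rfl⟩ := Submodule.mem_span_singleton.1 hu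
  obtain ⟨a, b, h2⟩ := Submodule.mem_span_pair.1 h1
  refine ⟨(c * b) • G v, Submodule.smul_mem _ _ (Submodule.mem_span_singleton_self _), ?_⟩
  rw [← h2, smul_add, smul_smul, smul_smul, add_sub_cancel_right]
  exact Submodule.smul_mem _ _ (Submodule.mem_span_singleton_self _)

/-- The normalised representative is unique: a nonzero difference of two candidates would lie in
both `⟨g⟩` and `⟨v⟩`, forcing `u'` into `⟨v⟩`. -/
theorem eq_of_sub_mem {g v u' v₁ v₂ : V'} (hu : u' ∉ K' ∙ v)
    (h₁ : v₁ ∈ K' ∙ v) (h₂ : v₂ ∈ K' ∙ v) (h₁' : u' - v₁ ∈ K' ∙ g) (h₂' : u' - v₂ ∈ K' ∙ g) :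
    v₁ = v₂ := by
  by_contra hne
  have hne' : v₁ - v₂ ≠ 0 := sub_ne_zero.2 hne
  have ha : v₁ - v₂ ∈ K' ∙ g := by
    have := Submodule.sub_mem _ h₂' h₁'
    rwa [sub_sub_sub_cancel_left] at this
  have hb : v₁ - v₂ ∈ K' ∙ v := Submodule.sub_mem _ h₁ h₂
  have hg : g ∈ K' ∙ v := mem_span_singleton_trans (mem_span_singleton_symm hne' ha) hb
  refine hu ?_
  rw [← sub_add_cancel u' v₁]
  exact Submodule.add_mem _ (mem_span_singleton_trans h₁' hg) h₁

theorem IsFlatMap.ne_zero_of_sub_mem {G : V → V'} (h : IsFlatMap K K' Set.univ G) {u v : V}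
    {u' v' : V'} (hu : u' ∈ K' ∙ G u) (hv : G v ≠ 0) (huv : u' ∉ K' ∙ G v)
    (hv' : u' - v' ∈ K' ∙ G (u - v)) : v' ≠ 0 := by
  rintro rfl
  rw [sub_zero] at hv'
  have hu0 : u' ≠ 0 := fun h0 => huv (h0 ▸ Submodule.zero_mem _)
  have h1 : G (u - v) ∈ K' ∙ u' := mem_span_singleton_symm hu0 hv'
  have h2 : G v ∈ Submodule.span K' {G u, G (u - v)} :=
    h.mem_span_pair (mem_span_pair_of_eq 1 (-1) (by simp))
  exact huv (mem_span_singleton_symm hv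
    (span_pair_le_singleton (mem_span_singleton_symm hu0 hu) h1 h2))

/-- `G (u - w)` lies both in the span of `u' - v'` and `v' - w'` and in the span of `u'` and `w'`.
By independence these planes meet only in the multiples of `u' - w'`. -/
theorem IsFlatMap.sub_mem_trans {G : V → V'} (h : IsFlatMap K K' Set.univ G) {u v w : V}
    {u' v' w' : V'} (hu : (K' ∙ u') = K' ∙ G u) (hw : (K' ∙ w') = K' ∙ G w)
    (hi : LinearIndependent K' ![u', v', w'])
    (huv : u' - v' ∈ K' ∙ G (u - v)) (hvw : v' - w' ∈ K' ∙ G (v - w)) :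
    u' - w' ∈ K' ∙ G (u - w) := by
  rw [linearIndependent_triple_iff] at hi
  have huv0 : u' - v' ≠ 0 := fun h0 => by
    have := (hi 1 (-1) 0 (by rw [← h0]; simp [sub_eq_add_neg])).1
    exact one_ne_zero this
  have hvw0 : v' - w' ≠ 0 := fun h0 => by
    have := (hi 0 1 (-1) (by rw [← h0]; simp [sub_eq_add_neg])).2.1
    exact one_ne_zero this
  have huw : u' ∉ K' ∙ w' := fun h0 => by
    obtain ⟨a, ha⟩ := Submodule.mem_span_singleton.1 h0
    exact one_ne_zero (hi 1 0 (-a) (by rw [← ha]; simp)).1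
  have h1 : G (u - w) ∈ Submodule.span K' {G (u - v), G (v - w)} :=
    h.mem_span_pair (mem_span_pair_of_eq 1 1 (by simp))
  have h2 : G (u - w) ∈ Submodule.span K' {G u, G w} :=
    h.mem_span_pair (mem_span_pair_of_eq 1 (-1) (by simp [sub_eq_add_neg]))
  have h3 : G u ∈ Submodule.span K' {G w, G (u - w)} :=
    h.mem_span_pair (mem_span_pair_of_eq 1 1 (by simp))
  rw [Submodule.span_insert, ← span_singleton_eq_of_mem huv0 huv,
    ← span_singleton_eq_of_mem hvw0 hvw, ← Submodule.span_insert] at h1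
  rw [Submodule.span_insert, ← hu, ← hw, ← Submodule.span_insert] at h2
  obtain ⟨a, b, hab⟩ := Submodule.mem_span_pair.1 h1
  obtain ⟨c, d, hcd⟩ := Submodule.mem_span_pair.1 h2
  have key := (hi (a - c) (b - a) (-b - d) (by
    rw [← sub_eq_zero.2 (hab.trans hcd.symm)]
    simp only [smul_sub, sub_smul, neg_smul]
    abel)).2.1
  have hba : b = a := sub_eq_zero.1 key
  subst hba
  have hg : b • (u' - w') = G (u - w) := by
    rw [← hab]; simp only [smul_sub]; abel
  -- If `G (u - w)` vanished, `G u` would lie in `⟨G w⟩`, against independence.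
  refine mem_span_singleton_symm (fun h0 => huw ?_)
    (Submodule.mem_span_singleton.2 ⟨b, hg⟩)
  rw [h0, Submodule.span_insert, Submodule.span_singleton_eq_bot.2 rfl, sup_bot_eq, ← hw] at h3
  exact mem_span_singleton_trans (hu ▸ Submodule.mem_span_singleton_self u') h3

end FlatMap

/-! ### Proportional additive maps and semilinearity -/

section Additive

variable {K V K' V' : Type*} [DivisionRing K] [AddCommGroup V] [Module K V]
  [DivisionRing K'] [AddCommGroup V'] [Module K' V']

/-- Comparing coefficients at `u + v` shows that the factors at `u` and `v` agree when `A u`, `A v`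
are independent. If `A v` is a nonzero multiple of `A p`, the comparison passes through `q`. -/
theorem exists_eq_smul_of_mem_span {A B : V →+ V'} (hB : ∀ v, B v ∈ K' ∙ A v)
    (hA : ∃ p q, LinearIndependent K' ![A p, A q]) : ∃ c : K', ∀ v, B v = c • A v := by
  choose c hc using fun v => Submodule.mem_span_singleton.1 (hB v)
  obtain ⟨p, q, hpq⟩ := hA
  have key : ∀ u v, LinearIndependent K' ![A u, A v] → c u = c v := by
    intro u v huv
    rw [LinearIndependent.pair_iff] at huv
    obtain ⟨h1, h2⟩ := huv (c (u + v) - c u) (c (u + v) - c v) (by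
      have := hc (u + v)
      rw [map_add, map_add, ← hc u, ← hc v] at this
      rw [sub_smul, sub_smul, ← sub_eq_zero.2 this, smul_add]
      abel)
    rw [← sub_eq_zero.1 h1, ← sub_eq_zero.1 h2]
  refine ⟨c p, fun v => ?_⟩
  by_cases hv0 : A v = 0
  · rw [← hc v, hv0, smul_zero, smul_zero]
  have hp0 : A p ≠ 0 := hpq.ne_zero 0
  rw [← hc v]
  congr 1
  by_cases hpv : LinearIndependent K' ![A p, A v]
  · exact (key p v hpv).symm
  · rw [LinearIndependent.pair_iff' hp0] at hpv
    push Not at hpv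
    obtain ⟨a, ha⟩ := hpv
    rw [key p q hpq]
    refine key v q ?_
    rw [LinearIndependent.pair_iff' hp0] at hpq
    rw [LinearIndependent.pair_iff' hv0]
    intro b hb
    exact hpq (b * a) (by rw [mul_smul, ha, hb])

/-- The constant factor relating `v ↦ A (a • v)` to `A` is `σ a`; the ring laws are read off at one
vector with nonzero image. -/
theorem exists_semilinearMap_of_additive (A : V →+ V') (h : ∀ (a : K) v, A (a • v) ∈ K' ∙ A v)
    (hA : ∃ p q, LinearIndependent K' ![A p, A q]) :
    ∃ (σ : K →+* K') (Φ : V →ₛₗ[σ] V'), ∀ v, Φ v = A v := by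
  have h1 : ∀ a : K, ∃ c : K', ∀ v, A (a • v) = c • A v := fun a =>
    exists_eq_smul_of_mem_span (A := A) (B := A.comp (DistribSMul.toAddMonoidHom V a)) (h a) hA
  choose s hs using h1
  obtain ⟨p, q, hpq⟩ := hA
  have hp0 : A p ≠ 0 := hpq.ne_zero 0
  have inj : ∀ {a b : K'}, a • A p = b • A p → a = b := fun h => smul_left_injective K' hp0 h
  refine ⟨{ toFun := s, map_one' := inj ?_, map_mul' := fun a b => inj ?_, map_zero' := inj ?_,
            map_add' := fun a b => inj ?_ },
    { toFun := A, map_add' := map_add A, map_smul' := hs }, fun v => rfl⟩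
  · rw [← hs, one_smul, one_smul]
  · rw [← hs, mul_smul, hs, hs, mul_smul]
  · rw [← hs, zero_smul, zero_smul, map_zero]
  · rw [← hs, add_smul, map_add, hs, hs, add_smul]

end Additive

/-! ### The fundamental theorem for everywhere defined flat maps -/

section Fundamental

variable {K V K' V' : Type*} [DivisionRing K] [AddCommGroup V] [Module K V]
  [DivisionRing K'] [AddCommGroup V'] [Module K' V']

/-- Compatible representatives of the values of `G` on three vectors with independent images. -/
theorem IsFlatMap.exists_frame {G : V → V'} (h : IsFlatMap K K' Set.univ G) {e : Fin 3 → V}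
    (he : LinearIndependent K' (G ∘ e)) :
    ∃ e' : Fin 3 → V', LinearIndependent K' e' ∧ (∀ i, (K' ∙ e' i) = K' ∙ G (e i)) ∧
      ∀ i j, e' i - e' j ∈ K' ∙ G (e i - e j) := by
  have h0 : G (e 0) ≠ 0 := he.ne_zero 0
  have hsymm : ∀ {u v u' v'}, u' - v' ∈ K' ∙ G (u - v) → v' - u' ∈ K' ∙ G (v - u) := by
    intro u v u' v' h1
    rw [← neg_sub u' v']
    refine Submodule.neg_mem _ (mem_span_singleton_trans h1 (h.mem_span_singleton ?_))
    exact Submodule.mem_span_singleton.2 ⟨-1, by simp⟩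
  have hnot : ∀ i, i ≠ 0 → G (e 0) ∉ K' ∙ G (e i) := by
    intro i hi hmem
    exact he.notMem_span_image (s := {i}) (x := 0) (by simpa using hi.symm) (by simpa using hmem)
  have hex : ∀ i, ∃ v', (K' ∙ v') = (K' ∙ G (e i)) ∧ G (e 0) - v' ∈ K' ∙ G (e 0 - e i) := by
    intro i
    by_cases hi : i = 0
    · subst hi
      exact ⟨G (e 0), rfl, by simp⟩
    · obtain ⟨v', hv', h2⟩ := h.exists_sub_mem (u := e 0) (v := e i)
        (Submodule.mem_span_singleton_self _)
      exact ⟨v', span_singleton_eq_of_mem (h.ne_zero_of_sub_mem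
        (Submodule.mem_span_singleton_self _) (he.ne_zero i) (hnot i hi) h2) hv', h2⟩
  choose f hf1 hf2 using hex
  set e' : Fin 3 → V' := ![G (e 0), f 1, f 2] with he'
  have hspan : ∀ i, (K' ∙ e' i) = K' ∙ G (e i) := by
    intro i
    fin_cases i
    · rfl
    · exact hf1 1
    · exact hf1 2
  have hli : LinearIndependent K' e' := by
    have hu : ∀ i, ∃ w : K'ˣ, e' i = w • G (e i) := by
      intro i
      have h3 : e' i ∈ K' ∙ G (e i) := hspan i ▸ Submodule.mem_span_singleton_self _
      obtain ⟨a, ha⟩ := Submodule.mem_span_singleton.1 h3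
      refine ⟨Units.mk0 a ?_, ha.symm⟩
      rintro rfl
      have h4 := hspan i
      rw [← ha, zero_smul, Submodule.span_singleton_eq_bot.2 rfl, eq_comm,
        Submodule.span_singleton_eq_bot] at h4
      exact he.ne_zero i h4
    choose w hw using hu
    have := he.units_smul w
    convert this using 1
    funext i
    exact hw i
  have h0i : ∀ i, e' 0 - e' i ∈ K' ∙ G (e 0 - e i) := by
    intro i
    fin_cases i
    · simp
    · exact hf2 1
    · exact hf2 2
  refine ⟨e', hli, hspan, fun i j => ?_⟩
  by_cases hi : i = 0
  · subst hi; exact h0i j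
  by_cases hj : j = 0
  · subst hj; exact hsymm (h0i i)
  by_cases hij : i = j
  · subst hij; simp
  -- Both vectors were normalised against `e 0`, so the remaining pair is compared through it.
  refine h.sub_mem_trans (hspan i) (hspan j) ?_ (hsymm (h0i i)) (h0i j)
  have := hli.comp ![i, 0, j] (by
    intro a b
    fin_cases a <;> fin_cases b <;>
      simp [hi, hj, hij, Ne.symm hi, Ne.symm hj, Ne.symm hij])
  convert this using 1
  funext k
  fin_cases k <;> rfl

/-- A lift of `G` compatible with a frame. -/
theorem IsFlatMap.exists_lift {G : V → V'} (h : IsFlatMap K K' Set.univ G) {e : Fin 3 → V}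
    {e' : Fin 3 → V'} (hli : LinearIndependent K' e') (hspan : ∀ i, (K' ∙ e' i) = K' ∙ G (e i))
    (hcomp : ∀ i j, e' i - e' j ∈ K' ∙ G (e i - e j)) (v : V) :
    ∃ v', (K' ∙ v') = (K' ∙ G v) ∧ ∀ i, e' i ∉ K' ∙ G v → e' i - v' ∈ K' ∙ G (e i - v) := by
  have he' : ∀ i, e' i ∈ K' ∙ G (e i) := fun i => hspan i ▸ Submodule.mem_span_singleton_self _
  by_cases hv : G v = 0
  · refine ⟨0, by rw [hv], fun i _ => ?_⟩
    obtain ⟨v', h1, h2⟩ := h.exists_sub_mem (v := v) (he' i)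
    rw [hv, Submodule.mem_span_singleton] at h1
    obtain ⟨a, rfl⟩ := h1
    rwa [smul_zero] at h2
  choose f hf1 hf2 using fun i => h.exists_sub_mem (v := v) (he' i)
  have hf3 : ∀ i, e' i ∉ K' ∙ G v → (K' ∙ f i) = K' ∙ G v := fun i hi =>
    span_singleton_eq_of_mem (h.ne_zero_of_sub_mem (he' i) hv hi (hf2 i)) (hf1 i)
  have hji : ∀ i j, i ≠ j → e' j ∉ K' ∙ e' i := by
    intro i j hij hmem
    exact hli.notMem_span_image (s := {i}) (x := j) (by simpa using hij.symm) (by simpa using hmem)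
  have hnot : ∀ i j k, k ≠ i → k ≠ j → e' k ∉ Submodule.span K' {e' i, e' j} := by
    intro i j k hki hkj hmem
    exact hli.notMem_span_image (s := {i, j}) (x := k) (by simp [hki, hkj])
      (by simpa [Set.image_pair] using hmem)
  have third : ∀ i j : Fin 3, ∃ k : Fin 3, k ≠ i ∧ k ≠ j := by decide
  -- In general position, `f i` is also normalised against `e j` by transitivity, so it equals `f j`
  -- by uniqueness.
  have key : ∀ i j, i ≠ j → e' i ∉ K' ∙ G v → e' j ∉ K' ∙ G v →
      G v ∉ Submodule.span K' {e' i, e' j} → f i = f j := by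
    intro i j hij hi hj hind
    refine eq_of_sub_mem hj (hf1 i) (hf1 j) ?_ (hf2 j)
    refine h.sub_mem_trans (hspan j) (hf3 i hi) (v' := e' i) ?_ (hcomp j i) (hf2 i)
    refine linearIndependent_triple_of_notMem (hli.ne_zero j) (hji j i hij.symm) ?_
    intro hmem
    rw [Set.pair_comm] at hmem
    have h1 : G v ∈ K' ∙ f i := hf3 i hi ▸ Submodule.mem_span_singleton_self _
    exact hind ((Submodule.span_singleton_le_iff_mem _ _).2 hmem h1)
  have key2 : ∀ i j, e' i ∉ K' ∙ G v → e' j ∉ K' ∙ G v → f i = f j := by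
    intro i j hi hj
    by_cases hij : i = j
    · rw [hij]
    by_cases hmem : G v ∈ Submodule.span K' {e' i, e' j}
    -- When `G v` lies in the span of `e' i` and `e' j`, the third frame vector `e' k` serves as
    -- intermediary: `G v` is then outside both spans involving `e' k`.
    · obtain ⟨k, hki, hkj⟩ := third i j
      have hk : e' k ∉ K' ∙ G v := fun h1 =>
        hnot i j k hki hkj ((Submodule.span_singleton_le_iff_mem _ _).2 hmem h1)
      have aux : ∀ i j : Fin 3, i ≠ j → k ≠ j → e' i ∉ K' ∙ G v →
          G v ∈ Submodule.span K' {e' i, e' j} → G v ∉ Submodule.span K' {e' i, e' k} := by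
        intro i j hij hkj hi h1 h2
        obtain ⟨a, b, hab⟩ := Submodule.mem_span_pair.1 h1
        have hb : b ≠ 0 := by
          rintro rfl
          rw [zero_smul, add_zero] at hab
          exact hi (mem_span_singleton_symm hv (Submodule.mem_span_singleton.2 ⟨a, hab⟩))
        have h3 : b • e' j ∈ Submodule.span K' {e' i, e' k} := by
          rw [← add_sub_cancel_left (a • e' i) (b • e' j), hab]
          exact Submodule.sub_mem _ h2
            (Submodule.smul_mem _ _ (Submodule.subset_span (Set.mem_insert _ _)))
        exact hnot i k j hij.symm hkj.symm ((Submodule.smul_mem_iff _ hb).1 h3)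
      have hmem' := hmem
      rw [Set.pair_comm] at hmem'
      exact (key i k hki.symm hi hk (aux i j hij hkj hi hmem)).trans
        (key j k hkj.symm hj hk (aux j i (Ne.symm hij) hki hj hmem')).symm
    · exact key i j hij hi hj hmem
  obtain ⟨i, hi⟩ := hli.exists_notMem_span_pair (G v) (G v)
  rw [Set.pair_eq_singleton] at hi
  refine ⟨f i, hf3 i hi, fun j hj => ?_⟩
  rw [key2 i j hi hj]
  exact hf2 j

theorem IsFlatMap.sub_mem_of_frame {Φ : V → V'} (h : IsFlatMap K K' Set.univ Φ)
    {e : Fin 3 → V} {e' : Fin 3 → V'} (hli : LinearIndependent K' e')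
    (hΦe : ∀ v i, e' i ∉ K' ∙ Φ v → e' i - Φ v ∈ K' ∙ Φ (e i - v)) {v w : V}
    (hvw : LinearIndependent K' ![Φ v, Φ w]) : Φ v - Φ w ∈ K' ∙ Φ (v - w) := by
  obtain ⟨i, hi⟩ := hli.exists_notMem_span_pair (Φ v) (Φ w)
  have hv0 : Φ v ≠ 0 := hvw.ne_zero 0
  have hv : Φ v ∈ Submodule.span K' {Φ v, Φ w} := Submodule.subset_span (Set.mem_insert _ _)
  have hw : Φ w ∈ Submodule.span K' {Φ v, Φ w} :=
    Submodule.subset_span (Set.mem_insert_of_mem _ rfl)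
  have hiv : e' i ∉ K' ∙ Φ v := fun h1 =>
    hi ((Submodule.span_singleton_le_iff_mem _ _).2 hv h1)
  have hiw : e' i ∉ K' ∙ Φ w := fun h1 =>
    hi ((Submodule.span_singleton_le_iff_mem _ _).2 hw h1)
  refine h.sub_mem_trans (u := v) (w := w) (v := e i) (v' := e' i) rfl rfl ?_ ?_ (hΦe w i hiw)
  · have h3 : LinearIndependent K' ![Φ v, Φ w, e' i] := by
      refine linearIndependent_triple_of_notMem hv0 (fun h4 => ?_) hi
      rw [LinearIndependent.pair_iff' hv0] at hvw
      obtain ⟨a, ha⟩ := Submodule.mem_span_singleton.1 h4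
      exact hvw a ha
    rw [linearIndependent_triple_iff] at h3 ⊢
    intro a b c habc
    have := h3 a c b (by rw [← habc]; abel)
    exact ⟨this.1, this.2.2, this.2.1⟩
  · rw [← neg_sub (e' i) (Φ v)]
    refine Submodule.neg_mem _ (mem_span_singleton_trans (hΦe v i hiv) (h.mem_span_singleton ?_))
    exact Submodule.mem_span_singleton.2 ⟨-1, by simp⟩

/-- `Φ (v - w)` is already some multiple `l` of `Φ v - Φ w`. The normalisation against a frame
vector `e' i` off the span of both values, with `e i - (v - w) = (e i - v) + w`, forces `l = 1`. -/
theorem IsFlatMap.map_sub_of_frame {Φ : V → V'} (h : IsFlatMap K K' Set.univ Φ)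
    {e : Fin 3 → V} {e' : Fin 3 → V'} (hli : LinearIndependent K' e')
    (hΦe : ∀ v i, e' i ∉ K' ∙ Φ v → e' i - Φ v ∈ K' ∙ Φ (e i - v)) {v w : V}
    (hvw : LinearIndependent K' ![Φ v, Φ w]) : Φ (v - w) = Φ v - Φ w := by
  obtain ⟨i, hi⟩ := hli.exists_notMem_span_pair (Φ v) (Φ w)
  have hne : Φ v - Φ w ≠ 0 := fun h0 =>
    one_ne_zero (LinearIndependent.pair_iff.1 hvw 1 (-1)
      (by rw [← h0]; simp [sub_eq_add_neg])).1
  have hs : (K' ∙ (Φ v - Φ w)) = K' ∙ Φ (v - w) :=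
    span_singleton_eq_of_mem hne (h.sub_mem_of_frame hli hΦe hvw)
  have hv : Φ v ∈ Submodule.span K' {Φ v, Φ w} := Submodule.subset_span (Set.mem_insert _ _)
  have hw : Φ w ∈ Submodule.span K' {Φ v, Φ w} :=
    Submodule.subset_span (Set.mem_insert_of_mem _ rfl)
  have hle : ∀ {x}, x ∈ Submodule.span K' {Φ v, Φ w} → e' i ∉ K' ∙ x := fun hx h1 =>
    hi ((Submodule.span_singleton_le_iff_mem _ _).2 hx h1)
  have hivw : e' i ∉ K' ∙ Φ (v - w) := hs ▸ hle (Submodule.sub_mem _ hv hw)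
  obtain ⟨l, hl⟩ := Submodule.mem_span_singleton.1
    (hs ▸ Submodule.mem_span_singleton_self (Φ (v - w)))
  have h1 := hΦe _ i hivw
  have h2 : Φ (e i - (v - w)) ∈ Submodule.span K' {Φ (e i - v), Φ w} :=
    h.mem_span_pair (mem_span_pair_of_eq 1 1 (by simp only [one_smul]; abel))
  have hne2 : e' i - Φ v ≠ 0 := fun h0 => hi (by rw [sub_eq_zero.1 h0]; exact hv)
  rw [Submodule.span_insert, ← span_singleton_eq_of_mem hne2 (hΦe v i (hle hv)),
    ← Submodule.span_insert] at h2
  obtain ⟨a, b, hab⟩ := Submodule.mem_span_pair.1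
    ((Submodule.span_singleton_le_iff_mem _ _).2 h2 h1)
  have h3 : LinearIndependent K' ![Φ v, Φ w, e' i] := by
    refine linearIndependent_triple_of_notMem (hvw.ne_zero 0) (fun h4 => ?_) hi
    obtain ⟨a, ha⟩ := Submodule.mem_span_singleton.1 h4
    exact (LinearIndependent.pair_iff' (hvw.ne_zero 0)).1 hvw a ha
  rw [linearIndependent_triple_iff] at h3
  obtain ⟨c1, -, c3⟩ := h3 (l - a) (b - l) (a - 1) (by
    rw [← hl] at hab
    rw [← sub_eq_zero.2 hab]
    simp only [smul_sub, sub_smul, one_smul]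
    abel)
  rw [← hl, sub_eq_zero.1 c1, sub_eq_zero.1 c3, one_smul]

/-- Adding `w` changes no span of values, so `Φ (v + w)` and `Φ v` satisfy the same normalisation
and coincide. -/
theorem IsFlatMap.map_add_of_frame_of_eq_zero {Φ : V → V'} (h : IsFlatMap K K' Set.univ Φ)
    {e : Fin 3 → V} {e' : Fin 3 → V'} (hli : LinearIndependent K' e')
    (hΦe : ∀ v i, e' i ∉ K' ∙ Φ v → e' i - Φ v ∈ K' ∙ Φ (e i - v)) {v w : V}
    (hw : Φ w = 0) : Φ (v + w) = Φ v := by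
  have h0 : ∀ x, (K' ∙ Φ (x + w)) = K' ∙ Φ x := by
    intro x
    apply le_antisymm <;> rw [Submodule.span_singleton_le_iff_mem]
    · have := h.mem_span_pair (u := x + w) (v := x) (w := w) (mem_span_pair_of_eq 1 1 (by simp))
      rwa [hw, Set.pair_comm, Submodule.span_insert_zero] at this
    · have := h.mem_span_pair (u := x) (v := x + w) (w := w)
        (mem_span_pair_of_eq 1 (-1) (by simp))
      rwa [hw, Set.pair_comm, Submodule.span_insert_zero] at this
  by_cases hv : Φ v = 0
  · have := h0 v
    rw [hv, Submodule.span_singleton_eq_bot.2 rfl, Submodule.span_singleton_eq_bot] at this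
    rw [this, hv]
  obtain ⟨i, hi⟩ := hli.exists_notMem_span_pair (Φ v) (Φ v)
  rw [Set.pair_eq_singleton] at hi
  refine eq_of_sub_mem (by rwa [h0 v]) (Submodule.mem_span_singleton_self _) ?_
    (hΦe _ i (by rwa [h0 v])) ?_
  · rw [h0 v]; exact Submodule.mem_span_singleton_self _
  · have h1 := hΦe v i hi
    have h2 := h0 (e i - (v + w))
    rw [show e i - (v + w) + w = e i - v by abel] at h2
    rwa [← h2]

/-- Negation comes from `(u - w) - u = -w`. For dependent nonzero values, an auxiliary `u` with
independent value is added and `Φ (v + w + u)` is computed with both bracketings. -/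
theorem IsFlatMap.map_add_of_map_sub {Φ : V → V'} (h : IsFlatMap K K' Set.univ Φ)
    (hindep : ∀ v, Φ v ≠ 0 → ∀ w, ∃ u, LinearIndependent K' ![Φ v, Φ u] ∧
      Φ u ∉ Submodule.span K' {Φ v, Φ w})
    (hsub : ∀ {v w}, LinearIndependent K' ![Φ v, Φ w] → Φ (v - w) = Φ v - Φ w)
    (hadd0 : ∀ {v w}, Φ w = 0 → Φ (v + w) = Φ v) (v w : V) : Φ (v + w) = Φ v + Φ w := by
  have hneg : ∀ w, Φ (-w) = -Φ w := by
    intro w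
    by_cases hw : Φ w = 0
    · have : Φ (-w) ∈ Submodule.span K' {Φ w, Φ w} :=
        h.mem_span_pair (mem_span_pair_of_eq (-1) 0 (by simp))
      rw [hw] at this ⊢
      simpa using this
    obtain ⟨u, hi, -⟩ := hindep w hw w
    have h1 := hsub (LinearIndependent.pair_symm_iff.1 hi)
    have h2 : LinearIndependent K' ![Φ (u - w), Φ u] := by
      rw [h1]
      rw [LinearIndependent.pair_iff] at hi ⊢
      intro s t hst
      have := hi (-s) (s + t) (by
        rw [← hst]; simp only [smul_sub, neg_smul, add_smul]; abel)
      have hs : s = 0 := neg_eq_zero.1 this.1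
      exact ⟨hs, by simpa [hs] using this.2⟩
    have h3 := hsub h2
    rw [h1, sub_sub_cancel_left, sub_sub_cancel_left] at h3
    exact h3
  have hadd' : ∀ {v w}, LinearIndependent K' ![Φ v, Φ w] → Φ (v + w) = Φ v + Φ w := by
    intro v w hvw
    have := hsub (v := v) (w := -w) (by
      rw [hneg]
      rw [LinearIndependent.pair_iff] at hvw ⊢
      intro s t hst
      have := hvw s (-t) (by simpa using hst)
      simpa using this)
    rwa [hneg, sub_neg_eq_add, sub_neg_eq_add] at this
  by_cases hw : Φ w = 0
  · rw [hadd0 hw, hw, add_zero]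
  by_cases hv : Φ v = 0
  · rw [add_comm v, hadd0 hv, hv, zero_add]
  obtain ⟨u, hi, hi'⟩ := hindep v hv w
  have hwi : LinearIndependent K' ![Φ w, Φ u] := by
    rw [LinearIndependent.pair_iff' hw]
    intro a ha
    refine hi' ?_
    rw [← ha]
    exact Submodule.smul_mem _ _ (Submodule.subset_span (Set.mem_insert_of_mem _ rfl))
  by_cases hvw : LinearIndependent K' ![Φ v, Φ w]
  · exact hadd' hvw
  rw [LinearIndependent.pair_iff' hv] at hvw
  push Not at hvw
  obtain ⟨a, ha⟩ := hvw
  have h1 : Φ (v + (w + u)) = Φ v + (Φ w + Φ u) := by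
    rw [← hadd' hwi]
    refine hadd' ?_
    rw [hadd' hwi, ← ha]
    rw [LinearIndependent.pair_iff] at hi ⊢
    intro s t hst
    have := hi (s + t * a) t (by
      rw [← hst]; simp only [smul_add, add_smul, mul_smul]; abel)
    have ht := this.2
    rw [ht, zero_mul, add_zero] at this
    exact ⟨this.1, ht⟩
  have h2 : Φ (v + w + u) = Φ (v + w) + Φ u := by
    by_cases h0 : Φ (v + w) = 0
    · rw [add_comm, hadd0 h0, h0, zero_add]
    refine hadd' ((LinearIndependent.pair_iff' h0).2 fun b hb => hi' ?_)
    rw [← hb]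
    exact Submodule.smul_mem _ _ (h.mem_span_pair (mem_span_pair_of_eq 1 1 (by simp)))
  rw [add_assoc, h1, ← add_assoc] at h2
  exact (add_right_cancel h2).symm

/-- The fundamental theorem of projective geometry, for partial maps which need not be injective
nor surjective on lines. -/
theorem IsFlatMap.exists_semilinearMap {G : V → V'} (h : IsFlatMap K K' Set.univ G) {e : Fin 3 → V}
    (he : LinearIndependent K' (G ∘ e)) :
    ∃ (σ : K →+* K') (Φ : V →ₛₗ[σ] V'), ∀ v, (K' ∙ Φ v) = K' ∙ G v := by
  obtain ⟨e', hli, hspan, hcomp⟩ := h.exists_frame he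
  choose Φ hΦ hΦe using h.exists_lift hli hspan hcomp
  have hf : IsFlatMap K K' Set.univ Φ := by
    intro T
    obtain ⟨W, hW⟩ := h T
    refine ⟨W, fun x hx => ?_⟩
    rw [hW x hx, ← Submodule.span_singleton_le_iff_mem, ← hΦ x,
      Submodule.span_singleton_le_iff_mem]
  simp only [← hΦ] at hspan hΦe
  -- A frame vector always serves as the auxiliary `u`.
  have hindep : ∀ v, Φ v ≠ 0 → ∀ w, ∃ u, LinearIndependent K' ![Φ v, Φ u] ∧
      Φ u ∉ Submodule.span K' {Φ v, Φ w} := by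
    intro v hv w
    obtain ⟨i, hi⟩ := hli.exists_notMem_span_pair (Φ v) (Φ w)
    have hi' : Φ (e i) ∉ Submodule.span K' {Φ v, Φ w} := by
      rw [← Submodule.span_singleton_le_iff_mem] at hi ⊢
      rwa [← hspan]
    refine ⟨e i, (LinearIndependent.pair_iff' hv).2 fun a ha => hi' ?_, hi'⟩
    rw [← ha]
    exact Submodule.smul_mem _ _ (Submodule.subset_span (Set.mem_insert _ _))
  have hadd := hf.map_add_of_map_sub hindep (hf.map_sub_of_frame hli hΦe)
    (hf.map_add_of_frame_of_eq_zero hli hΦe)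
  obtain ⟨σ, Ψ, hΨ⟩ := exists_semilinearMap_of_additive (K := K) (AddMonoidHom.mk' Φ hadd)
    (fun a v => hf.mem_span_singleton
      (Submodule.smul_mem _ _ (Submodule.mem_span_singleton_self _)))
    (by
      have h0 : Φ (e 0) ≠ 0 := fun h1 => hli.ne_zero 0 (by
        rw [← Submodule.span_singleton_eq_bot (R := K'), hspan, h1,
          Submodule.span_singleton_eq_bot])
      obtain ⟨u, hu, -⟩ := hindep (e 0) h0 0
      exact ⟨e 0, u, hu⟩)
  refine ⟨σ, Ψ, fun v => ?_⟩
  rw [hΨ]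
  exact hΦ v

end Fundamental

/-! ### Projections along a vector -/

section Away

variable {K V : Type*} [DivisionRing K] [AddCommGroup V] [Module K V]

theorem LinearIndependent.exists_dual_pair {e₁ e₂ : V} (h : LinearIndependent K ![e₁, e₂]) :
    ∃ f₁ f₂ : V →ₗ[K] K, f₁ e₁ = 1 ∧ f₁ e₂ = 0 ∧ f₂ e₁ = 0 ∧ f₂ e₂ = 1 := by
  obtain ⟨g, hg⟩ := LinearMap.exists_leftInverse_of_injective
    (Finsupp.linearCombination K ![e₁, e₂]) (LinearMap.ker_eq_bot.2 h)
  have h0 : g e₁ = Finsupp.single 0 1 := by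
    have := LinearMap.congr_fun hg (Finsupp.single 0 1)
    simpa using this
  have h1 : g e₂ = Finsupp.single 1 1 := by
    have := LinearMap.congr_fun hg (Finsupp.single 1 1)
    simpa using this
  exact ⟨(Finsupp.lapply 0).comp g, (Finsupp.lapply 1).comp g, by simp [h0], by simp [h1],
    by simp [h0], by simp [h1]⟩

/-- The projection along `e`, parallel to the kernel of `f`, when `f e = 1`. -/
def projAlong (f : V →ₗ[K] K) (e : V) : V →ₗ[K] V :=
  LinearMap.id - (LinearMap.toSpanSingleton K V e).comp f

theorem projAlong_apply (f : V →ₗ[K] K) (e v : V) : projAlong f e v = v - f v • e := rfl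

theorem projAlong_self {f : V →ₗ[K] K} {e : V} (h : f e = 1) : projAlong f e e = 0 := by
  rw [projAlong_apply, h, one_smul, sub_self]

theorem projAlong_idem {f : V →ₗ[K] K} {e : V} (h : f e = 1) (v : V) :
    projAlong f e (projAlong f e v) = projAlong f e v := by
  rw [projAlong_apply f e v, map_sub, map_smul, projAlong_self h, smul_zero, sub_zero,
    projAlong_apply]

theorem projAlong_of_eq_zero {f : V →ₗ[K] K} {e v : V} (h : f v = 0) : projAlong f e v = v := by
  rw [projAlong_apply, h, zero_smul, sub_zero]

theorem projAlong_comm {f₁ f₂ : V →ₗ[K] K} {e₁ e₂ : V} (h₁ : f₁ e₂ = 0) (h₂ : f₂ e₁ = 0) (v : V) :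
    projAlong f₁ e₁ (projAlong f₂ e₂ v) = projAlong f₂ e₂ (projAlong f₁ e₁ v) := by
  rw [projAlong_apply f₂ e₂ v, projAlong_apply f₁ e₁ v, map_sub, map_sub, map_smul, map_smul,
    projAlong_of_eq_zero h₁, projAlong_of_eq_zero h₂, projAlong_apply, projAlong_apply]
  abel

/-- A vector killed by both is a multiple of `e₂`, hence has `f₁ v = 0`. Thus two projections
together determine a vector. -/
theorem eq_zero_of_projAlong_eq_zero {f₁ f₂ : V →ₗ[K] K} {e₁ e₂ v : V} (h₁ : f₁ e₂ = 0)
    (h1 : projAlong f₁ e₁ v = 0) (h2 : projAlong f₂ e₂ v = 0) : v = 0 := by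
  rw [projAlong_apply, sub_eq_zero] at h1 h2
  have : f₁ v = 0 := by rw [h2, map_smul, h₁, smul_zero]
  rw [h1, this, zero_smul]

/-- Vectors independent modulo `⟨e₁, e₂⟩` stay independent after projecting twice. -/
theorem linearIndependent_projAlong {f₁ f₂ : V →ₗ[K] K} {e₁ e₂ a b : V}
    (h : LinearIndependent K ![e₁, e₂, a, b]) :
    LinearIndependent K ![projAlong f₁ e₁ (projAlong f₂ e₂ a),
      projAlong f₁ e₁ (projAlong f₂ e₂ b)] := by
  rw [Fintype.linearIndependent_iff] at h
  rw [LinearIndependent.pair_iff]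
  intro s t hst
  simp only [← map_smul, ← map_add] at hst
  rw [projAlong_apply, projAlong_apply f₂] at hst
  set p := s • a + t • b with hp
  have := h ![-f₁ (p - f₂ p • e₂), -f₂ p, s, t] (by
    rw [Fin.sum_univ_four]
    simp only [Matrix.cons_val]
    rw [← hst, hp]
    simp only [neg_smul]
    abel)
  exact ⟨this 2, this 3⟩

theorem linearIndependent_projAlong_three {f₁ : V →ₗ[K] K} {e₁ e₂ a b : V}
    (h : LinearIndependent K ![e₁, e₂, a, b]) :
    LinearIndependent K ![projAlong f₁ e₁ e₂, projAlong f₁ e₁ a, projAlong f₁ e₁ b] := by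
  rw [Fintype.linearIndependent_iff] at h
  rw [linearIndependent_triple_iff]
  intro r s t hst
  simp only [← map_smul, ← map_add] at hst
  rw [projAlong_apply] at hst
  set p := r • e₂ + s • a + t • b with hp
  have := h ![-f₁ p, r, s, t] (by
    rw [Fin.sum_univ_four]
    simp only [Matrix.cons_val]
    rw [← hst, hp]
    simp only [neg_smul]
    abel)
  exact ⟨this 1, this 2, this 3⟩

end Away

/-! ### Extending a flat map after projection from a centre -/

section Center

variable {K V K' V' : Type*} [DivisionRing K] [AddCommGroup V] [Module K V]
  [DivisionRing K'] [AddCommGroup V'] [Module K' V']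

variable (K) in
/-- Every line through `⟨c⟩` contains another point of the set `X` of vectors. -/
def IsCenter (X : Set V) (c : V) : Prop :=
  c ∈ X ∧ ∀ v ∉ K ∙ c, ∃ b : K, v + b • c ∈ X

theorem span_eq_span_of_forall_mem_iff {x y : V}
    (h : ∀ T : Submodule K V, x ∈ T ↔ y ∈ T) : (K ∙ x) = K ∙ y :=
  le_antisymm
    ((Submodule.span_singleton_le_iff_mem _ _).2 ((h _).2 (Submodule.mem_span_singleton_self _)))
    ((Submodule.span_singleton_le_iff_mem _ _).2 ((h _).1 (Submodule.mem_span_singleton_self _)))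

/-- A subspace cut out by a condition on `π ∘ F` contains `c`, so membership in it is unchanged by
adding multiples of `c`. The value at a translate lying in `X` can therefore be used at `v`, and `0`
on `⟨c⟩`. -/
theorem IsFlatMap.exists_extend {X : Set V} {F : V → V'} (h : IsFlatMap K K' X F) {c : V}
    (hc : IsCenter K X c) {π : V' →ₗ[K'] V'} (hπ : π (F c) = 0) :
    ∃ G : V → V', IsFlatMap K K' Set.univ G ∧ ∀ y ∈ X, (K' ∙ G y) = K' ∙ π (F y) := by
  classical
  choose! b hb using hc.2
  have key : ∀ T : Submodule K' V', ∃ W : Submodule K V, (∀ v,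
      v ∈ W ↔ (if v ∈ K ∙ c then 0 else π (F (v + b v • c))) ∈ T) ∧
      ∀ x ∈ X, x ∈ W ↔ π (F x) ∈ T := by
    intro T
    obtain ⟨W, hW⟩ := h (T.comap π)
    have hcW : c ∈ W := (hW c hc.1).2 (by simp [hπ])
    refine ⟨W, fun v => ?_, fun x hx => hW x hx⟩
    split_ifs with hv
    · exact ⟨fun _ => T.zero_mem, fun _ => (Submodule.span_singleton_le_iff_mem _ _).2 hcW hv⟩
    · rw [← Submodule.mem_comap, ← hW _ (hb v hv), W.add_mem_iff_left (W.smul_mem _ hcW)]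
  refine ⟨fun v => if v ∈ K ∙ c then 0 else π (F (v + b v • c)), fun T => ?_,
    fun y hy => span_eq_span_of_forall_mem_iff fun T => ?_⟩
  · obtain ⟨W, hW, -⟩ := key T
    exact ⟨W, fun v _ => hW v⟩
  · obtain ⟨W, hW, hWX⟩ := key T
    rw [← hW, hWX y hy]

theorem span_singleton_map {x y : V} (π : V →ₗ[K] V) (hxy : (K ∙ x) = K ∙ y) :
    (K ∙ π x) = K ∙ π y := by
  rw [← Set.image_singleton, ← Set.image_singleton, ← Submodule.map_span, ← Submodule.map_span,
    hxy]

theorem exists_units_of_span_eq {x y : V} (h : (K ∙ x) = K ∙ y) : ∃ u : Kˣ, x = u • y := by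
  obtain ⟨u, hu⟩ := Submodule.span_singleton_eq_span_singleton.1 h.symm
  exact ⟨u, hu.symm⟩

theorem LinearIndependent.of_span_eq {ι : Type*} {f g : ι → V} (hg : LinearIndependent K g)
    (h : ∀ i, (K ∙ f i) = K ∙ g i) : LinearIndependent K f := by
  choose u hu using fun i => exists_units_of_span_eq (h i)
  convert hg.units_smul u using 1
  funext i
  exact hu i

theorem IsFlatMap.exists_semilinearMap_projection {X : Set V} {F : V → V'}
    (h : IsFlatMap K K' X F) {c : V} (hc : IsCenter K X c) {π : V' →ₗ[K'] V'} (hπ : π (F c) = 0)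
    (hππ : ∀ v, π (π v) = π v) {a₁ a₂ a₃ : V} (h₁ : a₁ ∈ X) (h₂ : a₂ ∈ X) (h₃ : a₃ ∈ X)
    (hi : LinearIndependent K' ![π (F a₁), π (F a₂), π (F a₃)]) :
    ∃ (σ : K →+* K') (Φ : V →ₛₗ[σ] V'), (∀ y ∈ X, (K' ∙ Φ y) = K' ∙ π (F y)) ∧
      ∀ v, π (Φ v) = Φ v := by
  obtain ⟨G, hG, hGF⟩ := h.exists_extend hc hπ
  have hind : LinearIndependent K' (G ∘ ![a₁, a₂, a₃]) := by
    refine hi.of_span_eq fun i => ?_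
    fin_cases i
    exacts [hGF a₁ h₁, hGF a₂ h₂, hGF a₃ h₃]
  obtain ⟨σ, Φ, hΦ⟩ := hG.exists_semilinearMap hind
  -- Composing once more with the idempotent `π` leaves the spans over `X` unchanged and places all
  -- values in its range.
  refine ⟨σ, π.comp Φ, fun y hy => ?_, fun v => hππ _⟩
  have := span_singleton_map π ((hΦ y).trans (hGF y hy))
  rwa [hππ] at this

end Center

/-! ### Gluing the two projections -/

section Glue

variable {K V K' V' : Type*} [DivisionRing K] [AddCommGroup V] [Module K V]
  [DivisionRing K'] [AddCommGroup V'] [Module K' V']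

theorem linearIndependent_pair_of_span_eq {x y x' y' : V} (h : LinearIndependent K ![x', y'])
    (hx : (K ∙ x) = K ∙ x') (hy : (K ∙ y) = K ∙ y') : LinearIndependent K ![x, y] := by
  refine h.of_span_eq fun i => ?_
  fin_cases i
  exacts [hx, hy]

/-- Two semilinear maps which agree with `F` after projecting along `F v₁`, respectively `F v₂`,
come from a single one. -/
theorem IsFlatMap.exists_semilinearMap_glue {X : Set V} {F : V → V'} (h : IsFlatMap K K' X F)
    {v₁ v₂ z₁ z₂ : V} (hc₁ : IsCenter K X v₁) (hc₂ : IsCenter K X v₂) (hz₁ : z₁ ∈ X) (hz₂ : z₂ ∈ X)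
    (hi : LinearIndependent K' ![F v₁, F v₂, F z₁, F z₂]) {f₁ f₂ : V' →ₗ[K'] K'}
    (h11 : f₁ (F v₁) = 1) (h12 : f₁ (F v₂) = 0) (h21 : f₂ (F v₁) = 0) (h22 : f₂ (F v₂) = 1) :
    ∃ (σ : K →+* K') (Φ : V →ₛₗ[σ] V'), ∀ y ∈ X,
      (K' ∙ projAlong f₁ (F v₁) (Φ y)) = (K' ∙ projAlong f₁ (F v₁) (F y)) ∧
      (K' ∙ projAlong f₂ (F v₂) (Φ y)) = (K' ∙ projAlong f₂ (F v₂) (F y)) := by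
  set π₁ := projAlong f₁ (F v₁) with hπ₁
  set π₂ := projAlong f₂ (F v₂) with hπ₂
  have hi' : LinearIndependent K' ![F v₂, F v₁, F z₁, F z₂] := by
    convert hi.comp ![1, 0, 2, 3] (by decide) using 1
    funext i
    fin_cases i <;> rfl
  obtain ⟨σ, A, hA, hA'⟩ := h.exists_semilinearMap_projection hc₁ (π := π₁) (projAlong_self h11)
    (projAlong_idem h11) hc₂.1 hz₁ hz₂ (linearIndependent_projAlong_three hi)
  obtain ⟨τ, B, hB, -⟩ := h.exists_semilinearMap_projection hc₂ (π := π₂) (projAlong_self h22)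
    (projAlong_idem h22) hc₁.1 hz₁ hz₂ (linearIndependent_projAlong_three hi')
  have hcomm : ∀ v, π₁ (π₂ v) = π₂ (π₁ v) := projAlong_comm h12 h21
  have hAB : ∀ y ∈ X, (K' ∙ π₂ (A y)) = K' ∙ π₁ (B y) := by
    intro y hy
    rw [span_singleton_map π₂ (hA y hy), span_singleton_map π₁ (hB y hy), hcomm]
  have hA1 : A v₁ = 0 := by
    have := hA v₁ hc₁.1
    rwa [hπ₁, projAlong_self h11, Submodule.span_singleton_eq_bot.2 rfl,
      Submodule.span_singleton_eq_bot] at this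
  have hB1 : π₁ (B v₁) = 0 := by
    have := hAB v₁ hc₁.1
    rwa [hA1, map_zero, Submodule.span_singleton_eq_bot.2 rfl, eq_comm,
      Submodule.span_singleton_eq_bot] at this
  -- Both sides kill `v₁`, so proportionality passes from `X` to all of `V` by translation along
  -- `v₁`.
  have hmem : ∀ v, π₂ (A v) ∈ K' ∙ π₁ (B v) := by
    intro v
    by_cases hv : v ∈ K ∙ v₁
    · obtain ⟨a, rfl⟩ := Submodule.mem_span_singleton.1 hv
      rw [map_smulₛₗ A, hA1, smul_zero, map_zero]
      exact Submodule.zero_mem _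
    · obtain ⟨b, hb⟩ := hc₁.2 v hv
      have := hAB _ hb
      rw [map_add A, map_smulₛₗ A, hA1, smul_zero, add_zero, map_add B, map_smulₛₗ B, map_add π₁,
        map_smul π₁, hB1, smul_zero, add_zero] at this
      rw [← this]
      exact Submodule.mem_span_singleton_self _
  have hρ : LinearIndependent K' ![π₁ (π₂ (F z₁)), π₁ (π₂ (F z₂))] :=
    linearIndependent_projAlong hi
  have hBz : LinearIndependent K' ![π₁ (B z₁), π₁ (B z₂)] :=
    linearIndependent_pair_of_span_eq hρ (span_singleton_map π₁ (hB z₁ hz₁))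
      (span_singleton_map π₁ (hB z₂ hz₂))
  have hAz : LinearIndependent K' ![π₂ (A z₁), π₂ (A z₂)] :=
    linearIndependent_pair_of_span_eq hBz (hAB z₁ hz₁) (hAB z₂ hz₂)
  obtain ⟨c, hc⟩ := exists_eq_smul_of_mem_span (A := (π₁.comp B).toAddMonoidHom)
    (B := (π₂.comp A).toAddMonoidHom) hmem ⟨z₁, z₂, hBz⟩
  replace hc : ∀ v, π₂ (A v) = c • π₁ (B v) := hc
  have hc0 : c ≠ 0 := by
    rintro rfl
    exact hAz.ne_zero 0 (by simpa using hc z₁)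
  -- This makes `c • B` semilinear for `σ`, although `B` is so only for `τ`.
  have hστ : ∀ a, c * τ a = σ a * c := by
    intro a
    have h1 := hc (a • z₁)
    rw [map_smulₛₗ A, map_smulₛₗ B, map_smul π₂, map_smul π₁, hc, smul_smul, smul_smul] at h1
    exact (smul_left_injective K' (hBz.ne_zero 0 : π₁ (B z₁) ≠ 0) h1).symm
  -- `A` gives the map modulo `F v₁`; the missing coordinate along `F v₁` is read off from `c • B`.
  let Φ : V →ₛₗ[σ] V' :=
    { toFun := fun v => A v + f₁ (c • B v) • F v₁
      map_add' := fun v w => by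
        rw [map_add, map_add, smul_add, map_add, add_smul]; abel
      map_smul' := fun a v => by
        rw [map_smulₛₗ A, map_smulₛₗ B, smul_smul, hστ, mul_smul, map_smul f₁ (σ a), smul_eq_mul,
          mul_smul, smul_add] }
  have hΦ₁ : ∀ v, π₁ (Φ v) = A v := by
    intro v
    change π₁ (A v + f₁ (c • B v) • F v₁) = A v
    rw [map_add, map_smul, hA', hπ₁, projAlong_self h11, smul_zero, add_zero]
  have hΦ₂ : ∀ v, π₂ (Φ v) = c • B v := by
    intro v
    change π₂ (A v + f₁ (c • B v) • F v₁) = c • B v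
    rw [map_add, map_smul, hc, hπ₂, projAlong_of_eq_zero h21, ← map_smul, hπ₁, projAlong_apply,
      sub_add_cancel]
  refine ⟨σ, Φ, fun y hy => ⟨by rw [hΦ₁, hA y hy], ?_⟩⟩
  rw [hΦ₂, Submodule.span_singleton_smul_eq (IsUnit.mk0 c hc0), hB y hy]

/-- A weak form of having four points in general position in each plane. -/
def HasPlanePoints (K : Type*) {V : Type*} [DivisionRing K] [AddCommGroup V] [Module K V]
    (X : Set V) : Prop :=
  ∀ x ∈ X, ∀ z₁ ∈ X, ∀ z₂ ∈ X, LinearIndependent K ![x, z₁, z₂] →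
    ∃ z₃ ∈ X, z₃ ∈ Submodule.span K {x, z₁, z₂} ∧ z₃ ∉ (K ∙ x) ∧ z₃ ∉ Submodule.span K {z₁, z₂}

theorem IsFlatMap.exists_semilinearMap_of_centers {X : Set V} {F : V → V'}
    (h : IsFlatMap K K' X F) (hF : ∀ x ∈ X, F x ≠ 0) (hX : HasPlanePoints K X)
    {v₁ v₂ z₁ z₂ : V} (hc₁ : IsCenter K X v₁) (hc₂ : IsCenter K X v₂) (hz₁ : z₁ ∈ X) (hz₂ : z₂ ∈ X)
    (hi : LinearIndependent K' ![F v₁, F v₂, F z₁, F z₂]) :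
    ∃ (σ : K →+* K') (Φ : V →ₛₗ[σ] V'), ∀ x ∈ X, (K' ∙ Φ x) = K' ∙ F x := by
  obtain ⟨f₁, f₂, h11, h12, h21, h22⟩ := LinearIndependent.exists_dual_pair (K := K')
    (e₁ := F v₁) (e₂ := F v₂) (by
      convert hi.comp ![0, 1] (by decide) using 1
      funext i
      fin_cases i <;> rfl)
  obtain ⟨σ, Φ, hΦ⟩ := h.exists_semilinearMap_glue hc₁ hc₂ hz₁ hz₂ hi h11 h12 h21 h22
  set π₁ := projAlong f₁ (F v₁) with hπ₁
  set π₂ := projAlong f₂ (F v₂) with hπ₂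
  have hcomm : ∀ v, π₁ (π₂ v) = π₂ (π₁ v) := projAlong_comm h12 h21
  have hker : ∀ {v}, π₁ v = 0 → π₂ v = 0 → v = 0 := eq_zero_of_projAlong_eq_zero h12
  have hz : ∀ {x y : V'}, (K' ∙ x) = (K' ∙ y) → (x = 0 ↔ y = 0) := by
    intro x y hxy
    rw [← Submodule.span_singleton_eq_bot (R := K'), hxy, Submodule.span_singleton_eq_bot]
  have hne : ∀ x ∈ X, Φ x ≠ 0 := by
    intro x hx h0
    refine hF x hx (hker ?_ ?_)
    · rw [← hz (hΦ x hx).1, h0, map_zero]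
    · rw [← hz (hΦ x hx).2, h0, map_zero]
  have hρ : LinearIndependent K' ![π₁ (π₂ (F z₁)), π₁ (π₂ (F z₂))] :=
    linearIndependent_projAlong hi
  have hρΦ : ∀ x ∈ X, (K' ∙ π₁ (π₂ (Φ x))) = K' ∙ π₁ (π₂ (F x)) := fun x hx =>
    span_singleton_map π₁ (hΦ x hx).2
  -- The factors seen by the two projections agree on the nonzero double projection, so `Φ x` is a
  -- multiple of `F x`.
  have hgen : ∀ x ∈ X, π₁ (π₂ (F x)) ≠ 0 → (K' ∙ Φ x) = K' ∙ F x := by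
    intro x hx h0
    obtain ⟨u, hu⟩ := exists_units_of_span_eq (hΦ x hx).1
    obtain ⟨w, hw⟩ := exists_units_of_span_eq (hΦ x hx).2
    rw [Units.smul_def] at hu hw
    have huw : (u : K') = w := by
      refine smul_left_injective K' h0 ?_
      change (u : K') • π₁ (π₂ (F x)) = (w : K') • π₁ (π₂ (F x))
      rw [hcomm, ← map_smul π₂, ← hu, ← hcomm, hw, map_smul π₁, hcomm]
    have : Φ x - (u : K') • F x = 0 := by
      apply hker
      · rw [map_sub, hu, map_smul, sub_self]
      · rw [map_sub, hw, huw, map_smul, sub_self]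
    rw [sub_eq_zero.1 this, Submodule.span_singleton_smul_eq u.isUnit]
  refine ⟨σ, Φ, fun x hx => ?_⟩
  by_cases h0 : π₁ (π₂ (F x)) = 0
  swap
  · exact hgen x hx h0
  have hindep := LinearIndependent.pair_iff.1 hρ
  -- if a combination of `F x`, `F z₁`, `F z₂` is killed, only `F x` occurs in it
  have hFx : ∀ {a b c : K'}, a • F x + b • F z₁ + c • F z₂ ∈ LinearMap.ker (π₁.comp π₂) →
      b = 0 ∧ c = 0 := by
    intro a b c habc
    rw [LinearMap.mem_ker, LinearMap.comp_apply] at habc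
    simp only [map_add, map_smul, h0, smul_zero, zero_add] at habc
    exact hindep b c habc
  have hρz : LinearIndependent K' ![π₁ (π₂ (Φ z₁)), π₁ (π₂ (Φ z₂))] :=
    linearIndependent_pair_of_span_eq hρ (hρΦ z₁ hz₁) (hρΦ z₂ hz₂)
  have hΦx : π₁ (π₂ (Φ x)) = 0 := (hz (hρΦ x hx)).2 h0
  have hΦi : ∀ {a b c : K}, π₁ (π₂ (Φ (a • x + b • z₁ + c • z₂))) = 0 → b = 0 ∧ c = 0 := by
    intro a b c habc
    simp only [map_add, map_smulₛₗ, hΦx, smul_zero, zero_add, RingHom.id_apply] at habc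
    obtain ⟨hb, hc⟩ := LinearIndependent.pair_iff.1 hρz _ _ habc
    exact ⟨(map_eq_zero σ).1 hb, (map_eq_zero σ).1 hc⟩
  have hxz : LinearIndependent K ![x, z₁, z₂] := by
    rw [linearIndependent_triple_iff]
    intro a b c habc
    obtain ⟨rfl, rfl⟩ := hΦi (a := a) (b := b) (c := c) (by rw [habc]; simp)
    simp only [zero_smul, add_zero] at habc
    refine ⟨(smul_eq_zero.1 habc).resolve_right ?_, rfl, rfl⟩
    rintro rfl
    exact hne 0 hx (map_zero Φ)
  -- Here `F x` lies in the span of `F v₁` and `F v₂`. Avoiding `⟨x⟩` keeps `F z₃` outside that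
  -- span, so `hgen` applies to `z₃`; avoiding the span of `z₁`, `z₂` lets `x` be recovered from
  -- `z₁`, `z₂`, `z₃`.
  obtain ⟨z₃, hz₃, hspan, hz₃x, hz₃z⟩ := hX x hx z₁ hz₁ z₂ hz₂ hxz
  obtain ⟨a, b, c, rfl⟩ := Submodule.mem_span_triple.1 hspan
  have ha : a ≠ 0 := by
    rintro rfl
    exact hz₃z (Submodule.mem_span_pair.2 ⟨b, c, by simp⟩)
  have h3 : π₁ (π₂ (F (a • x + b • z₁ + c • z₂))) ≠ 0 := by
    intro h3
    obtain ⟨rfl, rfl⟩ := hΦi ((hz (hρΦ _ hz₃)).2 h3)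
    exact hz₃x (Submodule.mem_span_singleton.2 ⟨a, by simp⟩)
  have hz1 := hgen z₁ hz₁ (hρ.ne_zero 0)
  have hz2 := hgen z₂ hz₂ (hρ.ne_zero 1)
  have hz3 := hgen _ hz₃ h3
  set S := Submodule.span K' {F x, F z₁, F z₂} with hS
  have hSx : F x ∈ S := Submodule.subset_span (by simp)
  have hS1 : F z₁ ∈ S := Submodule.subset_span (by simp)
  have hS2 : F z₂ ∈ S := Submodule.subset_span (by simp)
  have hS3 : F (a • x + b • z₁ + c • z₂) ∈ S := by
    refine h.mem_of_mem_span (s := {x, z₁, z₂}) ?_ ?_ hz₃ hspan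
    · rintro _ (rfl | rfl | rfl) <;> assumption
    · rintro _ (rfl | rfl | rfl) <;> assumption
  have hle : ∀ {y z : V'}, (K' ∙ y) = (K' ∙ z) → z ∈ S → y ∈ S := by
    intro y z hyz hzS
    rw [← Submodule.span_singleton_le_iff_mem] at hzS ⊢
    rwa [hyz]
  have hΦS : Φ x ∈ S := by
    have h4 := hle hz3 hS3
    rw [map_add, map_add, map_smulₛₗ, map_smulₛₗ, map_smulₛₗ] at h4
    rw [S.add_mem_iff_left (S.smul_mem _ (hle hz2 hS2)),
      S.add_mem_iff_left (S.smul_mem _ (hle hz1 hS1))] at h4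
    exact (S.smul_mem_iff ((map_ne_zero σ).2 ha)).1 h4
  -- `Φ x` lies in `S` and is killed by the double projection, which leaves only multiples of `F x`.
  obtain ⟨a', b', c', habc⟩ := Submodule.mem_span_triple.1 hΦS
  obtain ⟨rfl, rfl⟩ := hFx (a := a') (b := b') (c := c')
    (by rw [habc, LinearMap.mem_ker, LinearMap.comp_apply, hΦx])
  simp only [zero_smul, add_zero] at habc
  exact span_singleton_eq_of_mem (hne x hx) (Submodule.mem_span_singleton.2 ⟨a', habc⟩)

end Glue

/-! ### Uniqueness, injectivity and reflection of spans -/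

section Extension

variable {K V K' V' : Type*} [DivisionRing K] [AddCommGroup V] [Module K V]
  [DivisionRing K'] [AddCommGroup V'] [Module K' V'] {σ τ : K →+* K'}

theorem exists_eq_smul_of_center {X : Set V} {Φ : V →ₛₗ[σ] V'} {Ψ : V →ₛₗ[τ] V'}
    (h : ∀ x ∈ X, (K' ∙ Φ x) = K' ∙ Ψ x) {c : V} (hc : IsCenter K X c) {π : V' →ₗ[K'] V'}
    (hπ : π (Φ c) = 0) (hi : ∃ p q, LinearIndependent K' ![π (Φ p), π (Φ q)]) :
    ∃ a : K', ∀ v, π (Ψ v) = a • π (Φ v) := by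
  have hπ' : π (Ψ c) = 0 := by
    have := span_singleton_map π (h c hc.1)
    rwa [hπ, Submodule.span_singleton_eq_bot.2 rfl, eq_comm,
      Submodule.span_singleton_eq_bot] at this
  refine exists_eq_smul_of_mem_span (A := (π.comp Φ).toAddMonoidHom)
    (B := (π.comp Ψ).toAddMonoidHom) (fun v => ?_) hi
  change π (Ψ v) ∈ K' ∙ π (Φ v)
  by_cases hv : v ∈ K ∙ c
  · obtain ⟨a, rfl⟩ := Submodule.mem_span_singleton.1 hv
    rw [map_smulₛₗ Ψ, map_smul π, hπ', smul_zero]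
    exact Submodule.zero_mem _
  · obtain ⟨b, hb⟩ := hc.2 v hv
    have := span_singleton_map π (h _ hb)
    rw [map_add Φ, map_add Ψ, map_smulₛₗ Φ, map_smulₛₗ Ψ, map_add π, map_add π, map_smul π,
      map_smul π, hπ, hπ', smul_zero, smul_zero, add_zero, add_zero] at this
    rw [this]
    exact Submodule.mem_span_singleton_self _

/-- After each projection `Ψ` is a constant multiple of `Φ`. The constants agree on the double
projection of `Φ z₁`, and the two projections are jointly injective. -/
theorem span_eq_span_of_centers {X : Set V} {Φ : V →ₛₗ[σ] V'} {Ψ : V →ₛₗ[τ] V'}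
    (h : ∀ x ∈ X, (K' ∙ Φ x) = K' ∙ Ψ x) {v₁ v₂ z₁ z₂ : V} (hc₁ : IsCenter K X v₁)
    (hc₂ : IsCenter K X v₂) (hz₁ : z₁ ∈ X)
    (hi : LinearIndependent K' ![Φ v₁, Φ v₂, Φ z₁, Φ z₂]) (v : V) :
    (K' ∙ Φ v) = K' ∙ Ψ v := by
  obtain ⟨f₁, f₂, h11, h12, h21, h22⟩ := LinearIndependent.exists_dual_pair (K := K')
    (e₁ := Φ v₁) (e₂ := Φ v₂) (by
      convert hi.comp ![0, 1] (by decide) using 1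
      funext i
      fin_cases i <;> rfl)
  have hcomm : ∀ v, projAlong f₁ (Φ v₁) (projAlong f₂ (Φ v₂) v) =
    projAlong f₂ (Φ v₂) (projAlong f₁ (Φ v₁) v) := projAlong_comm h12 h21
  have hρ := linearIndependent_projAlong (f₁ := f₁) (f₂ := f₂) hi
  have hpair : ∀ {π : V' →ₗ[K'] V'} {a b : V'}, LinearIndependent K' ![π a, π b] →
      LinearIndependent K' ![a, b] := by
    intro π a b hab
    refine LinearIndependent.of_comp π ?_
    convert hab using 1
    funext i
    fin_cases i <;> rfl
  obtain ⟨a, ha⟩ := exists_eq_smul_of_center h hc₁ (projAlong_self h11)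
    ⟨z₁, z₂, hpair (π := projAlong f₂ (Φ v₂)) (by rwa [← hcomm, ← hcomm])⟩
  obtain ⟨b, hb⟩ := exists_eq_smul_of_center h hc₂ (projAlong_self h22) ⟨z₁, z₂, hpair hρ⟩
  have hρ0 : projAlong f₁ (Φ v₁) (projAlong f₂ (Φ v₂) (Φ z₁)) ≠ 0 := hρ.ne_zero 0
  have hab : a = b := by
    refine smul_left_injective K' hρ0 ?_
    change a • projAlong f₁ (Φ v₁) (projAlong f₂ (Φ v₂) (Φ z₁)) =
      b • projAlong f₁ (Φ v₁) (projAlong f₂ (Φ v₂) (Φ z₁))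
    have e := congrArg (projAlong f₂ (Φ v₂)) (ha z₁)
    rw [map_smul, ← hcomm, ← hcomm, hb, map_smul] at e
    exact e.symm
  subst hab
  have hΨ : ∀ v, Ψ v = a • Φ v := by
    intro v
    refine sub_eq_zero.1 (eq_zero_of_projAlong_eq_zero (f₂ := f₂) (e₁ := Φ v₁) h12 ?_ ?_)
    · rw [map_sub, map_smul, ha, sub_self]
    · rw [map_sub, map_smul, hb, sub_self]
  have ha0 : a ≠ 0 := by
    rintro rfl
    have := h z₁ hz₁
    rw [hΨ, zero_smul, Submodule.span_singleton_eq_bot.2 rfl,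
      Submodule.span_singleton_eq_bot] at this
    exact hi.ne_zero 2 this
  rw [hΨ, Submodule.span_singleton_smul_eq (IsUnit.mk0 a ha0)]

/-- A kernel vector `v` off `⟨c⟩` would give `v + b • c` in `X` with the same image point as `c`. -/
theorem injective_of_center {X : Set V} {Φ : V →ₛₗ[σ] V'} (h0 : ∀ x ∈ X, Φ x ≠ 0)
    (h : ∀ x ∈ X, ∀ y ∈ X, (K' ∙ Φ x) = (K' ∙ Φ y) → x ∈ K ∙ y) {c : V} (hc : IsCenter K X c) :
    Function.Injective Φ := by
  rw [injective_iff_map_eq_zero]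
  intro v hv
  by_cases hvc : v ∈ K ∙ c
  · obtain ⟨a, rfl⟩ := Submodule.mem_span_singleton.1 hvc
    rw [map_smulₛₗ, smul_eq_zero, map_eq_zero] at hv
    rw [hv.resolve_right (h0 c hc.1), zero_smul]
  · obtain ⟨b, hb⟩ := hc.2 v hvc
    have hy : Φ (v + b • c) = σ b • Φ c := by rw [map_add, hv, zero_add, map_smulₛₗ]
    have h1 := h _ hb c hc.1 (span_singleton_eq_of_mem (h0 _ hb)
      (Submodule.mem_span_singleton.2 ⟨σ b, hy.symm⟩))
    rw [Submodule.add_mem_iff_left _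
      (Submodule.smul_mem _ _ (Submodule.mem_span_singleton_self c))] at h1
    exact absurd h1 hvc

/-- If `Φ` maps some basis to an independent family, then it reflects membership in spans. -/
theorem mem_of_map_mem_span_of_basis {ι : Type*} (B : Module.Basis ι K V) {Φ : V →ₛₗ[σ] V'}
    (h : LinearIndependent K' (Φ ∘ B)) {W : Submodule K V} {v : V}
    (hv : Φ v ∈ Submodule.span K' (Φ '' W)) : v ∈ W := by
  by_contra hvW
  obtain ⟨l, hlv, hlW⟩ := W.exists_le_ker_of_notMem hvW
  obtain ⟨g, hg⟩ := LinearMap.exists_leftInverse_of_injective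
    (Finsupp.linearCombination K' (Φ ∘ B)) (LinearMap.ker_eq_bot.2 h)
  have hgB : ∀ i, g (Φ (B i)) = Finsupp.single i 1 := by
    intro i
    simpa using LinearMap.congr_fun hg (Finsupp.single i 1)
  -- Independence of the images allows the form `l` separating `v` from `W` to be transported: `l' ∘
  -- Φ = σ ∘ l`.
  let l' : V' →ₗ[K'] K' := (Finsupp.linearCombination K' fun i => σ (l (B i))).comp g
  have hl' : l'.comp Φ = (σ.toSemilinearMap.comp l : V →ₛₗ[σ] K') := by
    refine B.ext fun i => ?_
    simp [l', hgB]
  have hl'' : ∀ u, l' (Φ u) = σ (l u) := fun u => LinearMap.congr_fun hl' u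
  have hle : Submodule.span K' (Φ '' W) ≤ LinearMap.ker l' := by
    rw [Submodule.span_le]
    rintro _ ⟨w, hw, rfl⟩
    rw [SetLike.mem_coe, LinearMap.mem_ker, hl'', LinearMap.mem_ker.1 (hlW hw), map_zero]
  have := hle hv
  rw [LinearMap.mem_ker, hl'', map_eq_zero] at this
  exact hlv this

/-- For `W` containing `c`, translation along `c` carries the trace condition from `X` to `V`. This
suffices to show that a basis containing `c` has independent image, which settles arbitrary `W`. -/
theorem mem_of_map_mem_span_of_center {X : Set V} {Φ : V →ₛₗ[σ] V'} (h0 : ∀ x ∈ X, Φ x ≠ 0)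
    (h : ∀ W : Submodule K V, ∃ T : Submodule K' V', ∀ x ∈ X, x ∈ W ↔ Φ x ∈ T)
    {c : V} (hc : IsCenter K X c) {W : Submodule K V} {v : V}
    (hv : Φ v ∈ Submodule.span K' (Φ '' W)) : v ∈ W := by
  have key : ∀ {W : Submodule K V} {v : V}, c ∈ W → Φ v ∈ Submodule.span K' (Φ '' W) → v ∈ W := by
    intro W v hcW hv
    obtain ⟨T, hT⟩ := h W
    have hcT : Φ c ∈ T := (hT c hc.1).1 hcW
    have hWT : ∀ w, w ∈ W ↔ Φ w ∈ T := by
      intro w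
      by_cases hw : w ∈ K ∙ c
      · obtain ⟨a, rfl⟩ := Submodule.mem_span_singleton.1 hw
        rw [map_smulₛₗ]
        exact ⟨fun _ => T.smul_mem _ hcT, fun _ => W.smul_mem _ hcW⟩
      · obtain ⟨b, hb⟩ := hc.2 w hw
        rw [← W.add_mem_iff_left (W.smul_mem b hcW), hT _ hb, map_add, map_smulₛₗ,
          T.add_mem_iff_left (T.smul_mem _ hcT)]
    refine (hWT v).2 (Submodule.span_le.2 ?_ hv)
    rintro _ ⟨w, hw, rfl⟩
    exact (hWT w).1 hw
  have hc0 : c ≠ 0 := fun hc0 => h0 c hc.1 (by rw [hc0, map_zero])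
  have hs : LinearIndepOn K id ({c} : Set V) := by
    rw [linearIndepOn_singleton_iff]
    exact hc0
  have hcs := Module.Basis.subset_extend hs (Set.mem_singleton c)
  refine mem_of_map_mem_span_of_basis (Module.Basis.extend hs) ?_ hv
  set B := Module.Basis.extend hs with hB
  have hBc : B ⟨c, hcs⟩ = c := by rw [hB, Module.Basis.coe_extend]
  classical
  rw [linearIndependent_iff']
  intro s g hg
  -- The span of the other basis vectors contains `c`, so `key` applies to it; only the coefficient
  -- of `c` is left, and `Φ c ≠ 0`.
  have hne : ∀ i ∈ s, B i ≠ c → g i = 0 := by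
    intro i hi hic
    by_contra hgi
    have h1 : g i • Φ (B i) ∈ Submodule.span K'
        (Φ '' (Submodule.span K (B '' {j | j ≠ i}) : Submodule K V)) := by
      rw [← Finset.add_sum_erase _ _ hi, Function.comp_apply] at hg
      rw [eq_neg_of_add_eq_zero_left hg]
      refine Submodule.neg_mem _ (Submodule.sum_mem _ fun j hj => Submodule.smul_mem _ _ ?_)
      exact Submodule.subset_span ⟨B j, Submodule.subset_span ⟨j, Finset.ne_of_mem_erase hj, rfl⟩,
        rfl⟩
    rw [Submodule.smul_mem_iff _ hgi] at h1
    refine B.linearIndependent.notMem_span_image (s := {j | j ≠ i}) (x := i) (by simp)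
      (key (Submodule.subset_span ⟨⟨c, hcs⟩, ?_, hBc⟩) h1)
    rintro rfl
    exact hic hBc
  intro i hi
  by_cases hic : B i = c
  · rw [Finset.sum_eq_single i] at hg
    · refine (smul_eq_zero.1 hg).resolve_right ?_
      rw [Function.comp_apply, hic]
      exact h0 c hc.1
    · intro j hj hji
      rw [hne j hj fun hjc => hji (B.injective (hjc.trans hic.symm)), zero_smul]
    · exact fun h => absurd hi h
  · exact hne i hi hic

end Extension

/-! ### From projective geometry to vectors -/

section Translation

variable {K V : Type*} [DivisionRing K] [AddCommGroup V] [Module K V]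

theorem mem_flats_projGeometry_iff {S : Set (ℙ K V)} :
    S ∈ (projGeometry K V).flats ↔ ∃ W : Submodule K V, ∀ p, p ∈ S ↔ p.rep ∈ W := by
  constructor
  · rintro ⟨T, rfl⟩
    refine ⟨Projectivization.Subspace.submodule T, fun p => ?_⟩
    rw [Projectivization.Subspace.mem_submodule_iff T p.rep_nonzero, p.mk_rep]
    rfl
  · rintro ⟨W, hW⟩
    refine ⟨W.projectivization, ?_⟩
    ext p
    rw [hW, SetLike.mem_coe, ← Submodule.mk_mem_projectivization_iff W p.rep_nonzero, p.mk_rep]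

theorem span_rep_mk (v : V) (hv : v ≠ 0) : (K ∙ (Projectivization.mk K v hv).rep) = K ∙ v := by
  rw [← Projectivization.submodule_eq, Projectivization.submodule_mk]

theorem rep_mk_mem_iff {W : Submodule K V} {v : V} {hv : v ≠ 0} :
    (Projectivization.mk K v hv).rep ∈ W ↔ v ∈ W := by
  rw [← Submodule.span_singleton_le_iff_mem, span_rep_mk, Submodule.span_singleton_le_iff_mem]

/-- As `q.rep` is nonzero, equality of spans already includes `v ≠ 0`; for partial maps it encodes
definedness and value together. -/
theorem exists_mk_eq_iff {v : V} {q : ℙ K V} :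
    (∃ h : v ≠ 0, Projectivization.mk K v h = q) ↔ (K ∙ v) = K ∙ q.rep := by
  constructor
  · rintro ⟨h, rfl⟩
    rw [span_rep_mk]
  · intro h
    have hv : v ≠ 0 := by
      rintro rfl
      rw [Submodule.span_singleton_eq_bot.2 rfl, eq_comm, Submodule.span_singleton_eq_bot] at h
      exact q.rep_nonzero h
    refine ⟨hv, Projectivization.submodule_injective ?_⟩
    rw [Projectivization.submodule_mk, h, Projectivization.submodule_eq]

theorem mem_cl_projGeometry_iff {A : Set (ℙ K V)} {p : ℙ K V} :
    p ∈ (projGeometry K V).cl A ↔ p.rep ∈ Submodule.span K (Projectivization.rep '' A) := by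
  constructor
  · intro h
    obtain ⟨W, hW⟩ := mem_flats_projGeometry_iff.1 ((projGeometry K V).cl_mem A)
    have hS : {p : ℙ K V | p.rep ∈ Submodule.span K (Projectivization.rep '' A)} ∈
        (projGeometry K V).flats :=
        mem_flats_projGeometry_iff.2 ⟨Submodule.span K (Projectivization.rep '' A), fun p => Iff.rfl⟩
    exact (projGeometry K V).cl_subset hS
      (fun q hq => Submodule.subset_span (Set.mem_image_of_mem _ hq)) h
  · intro h
    obtain ⟨W, hW⟩ := mem_flats_projGeometry_iff.1 ((projGeometry K V).cl_mem A)
    rw [hW]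
    refine Submodule.span_le.2 ?_ h
    rintro _ ⟨q, hq, rfl⟩
    exact (hW q).1 ((projGeometry K V).subset_cl A hq)

theorem indep_range_of_linearIndependent {ι : Type*} {p : ι → ℙ K V}
    (h : LinearIndependent K fun i => (p i).rep) : (projGeometry K V).Indep (Set.range p) := by
  rintro _ ⟨i, rfl⟩ hi
  rw [mem_cl_projGeometry_iff] at hi
  refine h.notMem_span_image (s := {j | j ≠ i}) (x := i) (by simp) (Submodule.span_mono ?_ hi)
  rintro _ ⟨_, ⟨⟨j, rfl⟩, hj⟩, rfl⟩
  exact ⟨j, fun hji => hj (hji ▸ rfl), rfl⟩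

theorem PointGeometry.Indep.sub {X : Type*} {G : PointGeometry X} {A : Set X} {B : Set A}
    (h : G.Indep (Subtype.val '' B)) : (G.sub A).Indep B := by
  intro b hb hmem
  rw [PointGeometry.sub_cl] at hmem
  refine h b.1 ⟨b, hb, rfl⟩ ?_
  rwa [Set.mem_preimage, Set.image_sdiff Subtype.val_injective, Set.image_singleton] at hmem

theorem encard_range_of_linearIndependent {m : ℕ} {ι : Type*} {p : ι → ℙ K V} {q : Fin (m + 1) → ι}
    (h : LinearIndependent K fun i => (p (q i)).rep) : (Set.range q).encard = m + 1 := by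
  have hq : Function.Injective q := fun i j hij => h.injective (by simp only [hij])
  rw [← Set.image_univ, hq.encard_image, Set.encard_univ]
  simp

theorem hasDim_of_linearIndependent {m : ℕ} {p : Fin (m + 1) → ℙ K V}
    (h : LinearIndependent K fun i => (p i).rep) :
    (projGeometry K V).HasDim ((projGeometry K V).cl (Set.range p)) m :=
  ⟨PointGeometry.cl_mem _ _, _, ⟨indep_range_of_linearIndependent h, rfl⟩,
    encard_range_of_linearIndependent (p := id) h⟩

theorem hasDim_sub_of_linearIndependent {X : Set (ℙ K V)} {m : ℕ} {p : Fin (m + 1) → X}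
    (h : LinearIndependent K fun i => (p i).1.rep) :
    ((projGeometry K V).sub X).HasDim (((projGeometry K V).sub X).cl (Set.range p)) m := by
  refine ⟨PointGeometry.cl_mem _ _, _, ⟨PointGeometry.Indep.sub ?_, rfl⟩,
    encard_range_of_linearIndependent h⟩
  rw [← Set.range_comp]
  exact indep_range_of_linearIndependent h

theorem mem_cl_sub_range_iff {X : Set (ℙ K V)} {ι : Type*} {p : ι → X} {q : X} :
    q ∈ ((projGeometry K V).sub X).cl (Set.range p) ↔
      q.1.rep ∈ Submodule.span K (Set.range fun i => (p i).1.rep) := by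
  rw [PointGeometry.sub_cl, Set.mem_preimage, mem_cl_projGeometry_iff, ← Set.range_comp,
    ← Set.range_comp]
  rfl

/-- The nonzero vectors representing points of `X`. -/
def coneOf (X : Set (ℙ K V)) : Set V := {v | ∃ h : v ≠ 0, Projectivization.mk K v h ∈ X}

theorem rep_mem_coneOf {X : Set (ℙ K V)} (x : X) : x.1.rep ∈ coneOf X :=
  ⟨x.1.rep_nonzero, by rw [Projectivization.mk_rep]; exact x.2⟩

theorem smul_mem_coneOf {X : Set (ℙ K V)} {v : V} (hv : v ∈ coneOf X) {a : K} (ha : a ≠ 0) :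
    a • v ∈ coneOf X := by
  obtain ⟨h, hX⟩ := hv
  refine ⟨smul_ne_zero ha h, ?_⟩
  convert hX using 1
  rw [Projectivization.mk_eq_mk_iff']
  exact ⟨a, rfl⟩

theorem hasPlanePoints_coneOf {X : Set (ℙ K V)} (hX : ((projGeometry K V).sub X).EnoughPoints) :
    HasPlanePoints K (coneOf X) := by
  rintro x ⟨hx, hxX⟩ y ⟨hy, hyX⟩ z ⟨hz, hzX⟩ hi
  set p : Fin 3 → X := ![⟨_, hxX⟩, ⟨_, hyX⟩, ⟨_, hzX⟩] with hp
  have hspan : ∀ i, (K ∙ (p i).1.rep) = K ∙ ![x, y, z] i := by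
    intro i
    fin_cases i
    exacts [span_rep_mk x hx, span_rep_mk y hy, span_rep_mk z hz]
  have hpi : LinearIndependent K fun i => (p i).1.rep := hi.of_span_eq hspan
  set l : Fin 2 → X := ![⟨_, hyX⟩, ⟨_, hzX⟩] with hl
  have hli : LinearIndependent K fun i => (l i).1.rep := by
    convert hpi.comp ![1, 2] (by decide) using 1
    funext i
    fin_cases i <;> rfl
  obtain ⟨Q, hQ, hQ4, hQ3⟩ := hX.2 _ (hasDim_sub_of_linearIndependent hpi)
  -- Discarding `x` leaves at least three of the four points, and these cannot all lie on the line
  -- through `y` and `z`.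
  obtain ⟨q, hqQ, hqx, hql⟩ : ∃ q ∈ Q, q ≠ ⟨_, hxX⟩ ∧
      q ∉ ((projGeometry K V).sub X).cl (Set.range l) := by
    by_contra! hcon
    have h3 : 3 ≤ (Q \ {⟨_, hxX⟩}).encard := by
      have h4 := Set.encard_le_encard_sdiff_add_encard Q {(⟨_, hxX⟩ : X)}
      rw [hQ4, Set.encard_singleton] at h4
      exact (ENat.add_le_add_iff_right (k := 1) (by simp)).1 (le_trans (by norm_num) h4)
    obtain ⟨T, hT, hT3⟩ := Set.exists_subset_encard_eq h3
    exact hQ3 T (hT.trans Set.sdiff_subset) hT3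
      ⟨_, hasDim_sub_of_linearIndependent hli, fun t ht => hcon t (hT ht).1 (hT ht).2⟩
  refine ⟨q.1.rep, rep_mem_coneOf q, ?_, ?_, ?_⟩
  · have := mem_cl_sub_range_iff.1 (hQ hqQ)
    refine (Submodule.span_le.2 ?_) this
    rintro _ ⟨i, rfl⟩
    refine (Submodule.span_singleton_le_iff_mem _ _).1 ((hspan i).trans_le ?_)
    rw [Submodule.span_singleton_le_iff_mem]
    apply Submodule.subset_span
    fin_cases i <;> simp
  · intro hmem
    apply hqx
    apply Subtype.ext
    apply Projectivization.submodule_injective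
    rw [Projectivization.submodule_mk, Projectivization.submodule_eq]
    exact span_singleton_eq_of_mem q.1.rep_nonzero hmem
  · intro hmem
    apply hql
    rw [mem_cl_sub_range_iff]
    refine (Submodule.span_le.2 ?_) hmem
    rintro _ (rfl | rfl)
    · exact rep_mk_mem_iff (hv := hy).1 (Submodule.subset_span ⟨0, rfl⟩)
    · exact rep_mk_mem_iff (hv := hz).1 (Submodule.subset_span ⟨1, rfl⟩)

/-- A point of `X` in the class of `⟨v⟩` has a representative `a • v + b • x` with `a ≠ 0`, as it
differs from `x`; rescaling gives the required translate. -/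
theorem isCenter_of_surjective {X : Set (ℙ K V)} {x : X}
    (hx : Function.Surjective ((projGeometry K V).subQuotMap X x)) :
    IsCenter K (coneOf X) x.1.rep := by
  refine ⟨rep_mem_coneOf x, fun v hv => ?_⟩
  have hv0 : v ≠ 0 := by
    rintro rfl
    exact hv (Submodule.zero_mem _)
  have hvx : Projectivization.mk K v hv0 ∉ ({x.1} : Set (ℙ K V)) := by
    intro h
    rw [Set.mem_singleton_iff] at h
    apply hv
    rw [← h, span_rep_mk]
    exact Submodule.mem_span_singleton_self v
  obtain ⟨y, hy⟩ := hx (Quotient.mk _ ⟨_, hvx⟩)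
  induction y using Quotient.inductionOn with
  | h y =>
  have h1 : (projGeometry K V).cl {y.1.1, x.1} =
      (projGeometry K V).cl {Projectivization.mk K v hv0, x.1} := Quotient.exact hy
  have h2 : y.1.1 ∈ (projGeometry K V).cl {Projectivization.mk K v hv0, x.1} :=
    h1 ▸ PointGeometry.subset_cl _ _ (Set.mem_insert _ _)
  rw [mem_cl_projGeometry_iff, Set.image_pair, Submodule.span_insert, span_rep_mk,
    ← Submodule.span_insert] at h2
  obtain ⟨a, b, hab⟩ := Submodule.mem_span_pair.1 h2
  have ha : a ≠ 0 := by
    rintro rfl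
    rw [zero_smul, zero_add] at hab
    refine y.2 (Subtype.ext (Projectivization.submodule_injective ?_))
    rw [Projectivization.submodule_eq, Projectivization.submodule_eq]
    exact span_singleton_eq_of_mem y.1.1.rep_nonzero (Submodule.mem_span_singleton.2 ⟨b, hab⟩)
  refine ⟨a⁻¹ * b, ?_⟩
  have := smul_mem_coneOf (rep_mem_coneOf y.1) (inv_ne_zero ha)
  rwa [← hab, smul_add, smul_smul, smul_smul, inv_mul_cancel₀ ha, one_smul] at this

end Translation

/-! ### Maps of points, images and embeddings -/

section RepMap

variable {K V K' V' : Type*} [DivisionRing K] [AddCommGroup V] [Module K V]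
  [DivisionRing K'] [AddCommGroup V'] [Module K' V']

theorem mem_projPartialMap_mk_iff {σ : K →+* K'} (Φ : V →ₛₗ[σ] V') {v : V} (hv : v ≠ 0)
    (q : ℙ K' V') :
    q ∈ projPartialMap Φ (Projectivization.mk K v hv) ↔ (K' ∙ Φ v) = K' ∙ q.rep := by
  rw [mem_projPartialMap_mk, exists_mk_eq_iff]

open Classical in
/-- A map on vectors inducing `φ` on points. -/
noncomputable def repMap {X : Set (ℙ K V)} (φ : X → ℙ K' V') (v : V) : V' :=
  if h : v ∈ coneOf X then (φ ⟨_, h.choose_spec⟩).rep else 0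

theorem repMap_eq {X : Set (ℙ K V)} (φ : X → ℙ K' V') {v : V} (hv : v ≠ 0)
    (hX : Projectivization.mk K v hv ∈ X) : repMap φ v = (φ ⟨_, hX⟩).rep :=
  dif_pos (show v ∈ coneOf X from ⟨hv, hX⟩)

theorem repMap_rep {X : Set (ℙ K V)} (φ : X → ℙ K' V') (x : X) :
    repMap φ x.1.rep = (φ x).rep := by
  have hx : Projectivization.mk K x.1.rep x.1.rep_nonzero ∈ X := by
    rw [Projectivization.mk_rep]; exact x.2
  rw [repMap_eq φ x.1.rep_nonzero hx]
  congr 2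
  exact Subtype.ext (Projectivization.mk_rep _)

theorem repMap_ne_zero {X : Set (ℙ K V)} (φ : X → ℙ K' V') {v : V} (hv : v ∈ coneOf X) :
    repMap φ v ≠ 0 := by
  obtain ⟨h, hX⟩ := hv
  rw [repMap_eq φ h hX]
  exact Projectivization.rep_nonzero _

theorem forall_mem_projPartialMap_iff {X : Set (ℙ K V)} {φ : X → ℙ K' V'} {σ : K →+* K'}
    {Φ : V →ₛₗ[σ] V'} : (∀ x : X, φ x ∈ projPartialMap Φ x) ↔
      ∀ v ∈ coneOf X, (K' ∙ Φ v) = K' ∙ repMap φ v := by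
  constructor
  · rintro h v ⟨hv, hX⟩
    rw [repMap_eq φ hv hX, ← mem_projPartialMap_mk_iff Φ hv]
    exact h ⟨_, hX⟩
  · intro h x
    have := h _ (rep_mem_coneOf x)
    rwa [repMap_rep, ← mem_projPartialMap_mk_iff Φ x.1.rep_nonzero, Projectivization.mk_rep] at this

theorem isFlatMap_repMap {X : Set (ℙ K V)} {φ : X → ℙ K' V'}
    (hφ : ((projGeometry K V).sub X).IsMorphism (projGeometry K' V') φ) :
    IsFlatMap K K' (coneOf X) (repMap φ) := by
  intro T
  obtain ⟨S, hS, hST⟩ := hφ {p | p.rep ∈ T} (mem_flats_projGeometry_iff.2 ⟨T, fun p => Iff.rfl⟩)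
  obtain ⟨W, hW⟩ := mem_flats_projGeometry_iff.1 hS
  refine ⟨W, ?_⟩
  rintro v ⟨hv, hX⟩
  rw [repMap_eq φ hv hX, ← rep_mk_mem_iff (hv := hv), ← hW]
  exact (Set.ext_iff.1 hST ⟨_, hX⟩).symm

theorem projPartialMap_congr {σ τ : K →+* K'} {Φ : V →ₛₗ[σ] V'} {Ψ : V →ₛₗ[τ] V'}
    (h : ∀ v, (K' ∙ Φ v) = K' ∙ Ψ v) : projPartialMap Φ = projPartialMap Ψ := by
  refine PFun.ext fun p q => ?_
  induction p using Projectivization.ind with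
  | h v hv => rw [mem_projPartialMap_mk_iff, mem_projPartialMap_mk_iff, h]

theorem projPartialMap_eq_coe {σ : K →+* K'} {Φ : V →ₛₗ[σ] V'} (hΦ : Function.Injective Φ) :
    projPartialMap Φ = (Projectivization.map Φ hΦ : ℙ K V →. ℙ K' V') := by
  refine PFun.ext fun p q => ?_
  induction p using Projectivization.ind with
  | h v hv =>
    rw [mem_projPartialMap_mk, PFun.coe_val, Part.mem_some_iff, Projectivization.map_mk]
    exact ⟨fun ⟨_, h⟩ => h.symm, fun h => ⟨_, h.symm⟩⟩

/-- The image contains a fourth point independent from at most three given ones. -/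
theorem exists_linearIndependent_cons {X : Type*} {φ : X → ℙ K' V'}
    (h_image : ∀ (S : Set (ℙ K' V')) (n : ℕ), n ≤ 2 → (projGeometry K' V').HasDim S n →
      ¬ Set.range φ ⊆ S) {m : ℕ} (hm : m ≤ 2) {p : Fin (m + 1) → ℙ K' V'}
    (hp : LinearIndependent K' fun i => (p i).rep) :
    ∃ x, LinearIndependent K' (Fin.cons (φ x).rep fun i => (p i).rep : Fin (m + 2) → V') := by
  obtain ⟨_, ⟨x, rfl⟩, hx⟩ := Set.not_subset.1
    (h_image _ m hm (hasDim_of_linearIndependent hp))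
  refine ⟨x, linearIndependent_finCons.2 ⟨hp, fun hmem => hx ?_⟩⟩
  rw [mem_cl_projGeometry_iff, ← Set.range_comp]
  exact hmem

/-- The image lies in no line and no plane, so the pair `φ x₁`, `φ x₂` can be enlarged twice. -/
theorem exists_linearIndependent_four {X : Type*} {φ : X → ℙ K' V'}
    (h_image : ∀ (S : Set (ℙ K' V')) (n : ℕ), n ≤ 2 → (projGeometry K' V').HasDim S n →
      ¬ Set.range φ ⊆ S) {x₁ x₂ : X} (h : φ x₁ ≠ φ x₂) :
    ∃ y₁ y₂, LinearIndependent K' ![(φ x₁).rep, (φ x₂).rep, (φ y₁).rep, (φ y₂).rep] := by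
  have h2 : LinearIndependent K' fun i => (![φ x₁, φ x₂] i).rep := by
    convert Projectivization.linearIndependent_pair_iff_ne.2 h using 1
    funext i
    fin_cases i <;> rfl
  obtain ⟨y₁, h3⟩ := exists_linearIndependent_cons h_image (by norm_num) h2
  have h3' : LinearIndependent K' fun i => (![φ y₁, φ x₁, φ x₂] i).rep := by
    convert h3 using 1
    funext i
    fin_cases i <;> rfl
  obtain ⟨y₂, h4⟩ := exists_linearIndependent_cons h_image le_rfl h3'
  refine ⟨y₁, y₂, ?_⟩
  convert h4.comp ![2, 3, 1, 0] (by decide) using 1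
  funext i
  fin_cases i <;> rfl

theorem PointGeometry.IsEmbedding.exists_flat {Y Y' : Type*} {G : PointGeometry Y}
    {G' : PointGeometry Y'} {f : Y → Y'} (hf : G.IsEmbedding G' f) {S : Set Y}
    (hS : S ∈ G.flats) : ∃ S' ∈ G'.flats, ∀ y, y ∈ S ↔ f y ∈ S' := by
  obtain ⟨-, -, g, hl, -, hg⟩ := hf
  obtain ⟨S', hS', h⟩ := hg S hS
  refine ⟨S', hS', fun y => ?_⟩
  have := Set.ext_iff.1 h (Set.rangeFactorization f y)
  rwa [Set.mem_preimage, hl y] at this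

theorem PointGeometry.isEmbedding_of_exists_flat {Y Y' : Type*} {G : PointGeometry Y}
    {G' : PointGeometry Y'} {f : Y → Y'} (hf : G.IsMorphism G' f) (hi : Function.Injective f)
    (h : ∀ S ∈ G.flats, ∃ S' ∈ G'.flats, ∀ y, y ∈ S ↔ f y ∈ S') : G.IsEmbedding G' f := by
  refine ⟨hf, ?_, (Equiv.ofInjective f hi).symm, (Equiv.ofInjective f hi).left_inv,
    (Equiv.ofInjective f hi).right_inv, ?_⟩
  · rintro _ ⟨S, hS, rfl⟩
    exact hf S hS
  · intro S hS
    obtain ⟨S', hS', hSS'⟩ := h S hS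
    refine ⟨S', hS', ?_⟩
    ext y
    rw [Set.mem_preimage, hSS', Equiv.apply_ofInjective_symm hi]
    rfl

theorem PointGeometry.IsEmbedding.injective {Y Y' : Type*} {G : PointGeometry Y}
    {G' : PointGeometry Y'} {f : Y → Y'} (hf : G.IsEmbedding G' f) : Function.Injective f := by
  obtain ⟨-, -, g, hl, -, -⟩ := hf
  intro x y hxy
  rw [← hl x, ← hl y]
  congr 1
  exact Subtype.ext hxy

/-- Each `W` is the preimage of the span of its image, so it is the trace of a flat of the target;
taking `W` to be a point gives injectivity. -/
theorem isEmbedding_map {σ : K →+* K'} {Φ : V →ₛₗ[σ] V'} (hΦ : Function.Injective Φ)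
    (h : ∀ (W : Submodule K V) v, Φ v ∈ Submodule.span K' (Φ '' W) → v ∈ W) :
    (projGeometry K V).IsEmbedding (projGeometry K' V') (Projectivization.map Φ hΦ) := by
  have hrep : ∀ (p : ℙ K V) (T : Submodule K' V'),
      (Projectivization.map Φ hΦ p).rep ∈ T ↔ Φ p.rep ∈ T := by
    intro p T
    conv_lhs => rw [← p.mk_rep, Projectivization.map_mk]
    exact rep_mk_mem_iff
  have hspan : ∀ (p : ℙ K V) (W : Submodule K V),
      p.rep ∈ W ↔ Φ p.rep ∈ Submodule.span K' (Φ '' W) := fun p W =>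
    ⟨fun hp => Submodule.subset_span ⟨_, hp, rfl⟩, h W _⟩
  refine PointGeometry.isEmbedding_of_exists_flat ?_ ?_ ?_
  · intro S hS
    obtain ⟨T, hT⟩ := mem_flats_projGeometry_iff.1 hS
    refine mem_flats_projGeometry_iff.2 ⟨T.comap Φ, fun p => ?_⟩
    rw [Set.mem_preimage, hT, hrep, Submodule.mem_comap]
  · intro p q hpq
    apply Projectivization.submodule_injective
    rw [Projectivization.submodule_eq, Projectivization.submodule_eq]
    refine span_singleton_eq_of_mem p.rep_nonzero ?_
    rw [hspan, ← hrep, hpq, hrep, ← hspan]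
    exact Submodule.mem_span_singleton_self _
  · intro S hS
    obtain ⟨W, hW⟩ := mem_flats_projGeometry_iff.1 hS
    refine ⟨_, mem_flats_projGeometry_iff.2
      ⟨Submodule.span K' (Φ '' W), fun p => (Iff.rfl : p ∈ {p | _} ↔ _)⟩, fun p => ?_⟩
    rw [hW, hspan]
    exact (hrep p _).symm

end RepMap

/-! ### The extension theorem -/

theorem mainTheorem6 {K V K' V' : Type*}
    [DivisionRing K] [AddCommGroup V] [Module K V]
    [DivisionRing K'] [AddCommGroup V'] [Module K' V']
    (X : Set (ℙ K V)) (hX : ((projGeometry K V).sub X).EnoughPoints)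
    (φ : X → ℙ K' V')
    (hφ : ((projGeometry K V).sub X).IsMorphism (projGeometry K' V') φ)
    (h_image : ∀ (S : Set (ℙ K' V')) (n : ℕ), n ≤ 2 → (projGeometry K' V').HasDim S n →
      ¬ Set.range φ ⊆ S)
    (h_points : ∃ x₁ x₂ : X,
      Function.Surjective ((projGeometry K V).subQuotMap X x₁) ∧
      Function.Surjective ((projGeometry K V).subQuotMap X x₂) ∧
      φ x₁ ≠ φ x₂) :
    ∃ ϕ : ℙ K V →. ℙ K' V',
      (IsPartialProjective ϕ ∧ ∀ x : X, φ x ∈ ϕ x) ∧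
      (∀ ψ : ℙ K V →. ℙ K' V', IsPartialProjective ψ → (∀ x : X, φ x ∈ ψ x) → ψ = ϕ) ∧
      (Function.Injective φ → ϕ.Dom = Set.univ) ∧
      (((projGeometry K V).sub X).IsEmbedding (projGeometry K' V') φ →
        ∃ f : ℙ K V → ℙ K' V', ϕ = (f : ℙ K V →. ℙ K' V') ∧
          (projGeometry K V).IsEmbedding (projGeometry K' V') f) := by
  obtain ⟨x₁, x₂, hx₁, hx₂, hne⟩ := h_points
  have hc₁ := isCenter_of_surjective hx₁
  have hc₂ := isCenter_of_surjective hx₂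
  obtain ⟨y₁, y₂, hi⟩ := exists_linearIndependent_four h_image hne
  simp only [← repMap_rep φ] at hi
  have hy₁ := rep_mem_coneOf y₁
  have hy₂ := rep_mem_coneOf y₂
  obtain ⟨σ, Φ, hΦ⟩ := (isFlatMap_repMap hφ).exists_semilinearMap_of_centers
    (fun x hx => repMap_ne_zero φ hx) (hasPlanePoints_coneOf hX) hc₁ hc₂ hy₁ hy₂ hi
  have h0 : ∀ v ∈ coneOf X, Φ v ≠ 0 := by
    intro v hv h
    have := hΦ v hv
    rw [h, Submodule.span_singleton_eq_bot.2 rfl, eq_comm, Submodule.span_singleton_eq_bot] at this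
    exact repMap_ne_zero φ hv this
  have hinj : Function.Injective φ → Function.Injective Φ := by
    intro hφi
    refine injective_of_center (K' := K') h0 ?_ hc₁
    rintro x hx y hy hxy
    rw [hΦ x hx, hΦ y hy] at hxy
    obtain ⟨hx, hxX⟩ := hx
    obtain ⟨hy, hyX⟩ := hy
    rw [repMap_eq φ hx hxX, repMap_eq φ hy hyX, ← Projectivization.submodule_eq,
      ← Projectivization.submodule_eq] at hxy
    have := Subtype.ext_iff.1 (hφi (Projectivization.submodule_injective hxy))
    obtain ⟨a, ha⟩ := (Projectivization.mk_eq_mk_iff' K x y hx hy).1 this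
    exact Submodule.mem_span_singleton.2 ⟨a, ha⟩
  refine ⟨projPartialMap Φ, ⟨⟨σ, Φ, rfl⟩, forall_mem_projPartialMap_iff.2 hΦ⟩, ?_, ?_, ?_⟩
  · rintro _ ⟨τ, Ψ, rfl⟩ hΨ
    rw [forall_mem_projPartialMap_iff] at hΨ
    refine (projPartialMap_congr (span_eq_span_of_centers (z₂ := y₂.1.rep)
      (fun x hx => (hΦ x hx).trans (hΨ x hx).symm) hc₁ hc₂ hy₁ (hi.of_span_eq fun i => ?_))).symm
    fin_cases i
    exacts [hΦ _ hc₁.1, hΦ _ hc₂.1, hΦ _ hy₁, hΦ _ hy₂]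
  · intro hφi
    rw [projPartialMap_eq_coe (hinj hφi)]
    rfl
  · intro hemb
    have hΦi := hinj hemb.injective
    refine ⟨_, projPartialMap_eq_coe hΦi, isEmbedding_map hΦi fun W v =>
      mem_of_map_mem_span_of_center (X := coneOf X) h0 ?_ hc₁⟩
    intro W
    -- The inverse morphism turns the trace of `W` on `X` into the trace of a subspace `T` on the
    -- image.
    obtain ⟨S', hS', hS⟩ := hemb.exists_flat (S := Subtype.val ⁻¹' {p | p.rep ∈ W})
      ⟨_, mem_flats_projGeometry_iff.2 ⟨W, fun p => Iff.rfl⟩, rfl⟩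
    obtain ⟨T, hT⟩ := mem_flats_projGeometry_iff.1 hS'
    refine ⟨T, fun x hx => ?_⟩
    have h1 := hΦ x hx
    obtain ⟨hx0, hxX⟩ := hx
    rw [← Submodule.span_singleton_le_iff_mem (p := T), h1, Submodule.span_singleton_le_iff_mem,
      repMap_eq φ hx0 hxX, ← hT, ← hS]
    exact rep_mk_mem_iff.symm
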